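/- All notions are those of computable analysis. A problem is a partial multivalued function $f:\subseteq\mathbf X\rightrightarrows\mathbf Y$ between represented spaces, $\leq_{\mathrm W}$ is Weihrauch reducibility, and the first-order part ${}^1(f)$ is the greatest Weihrauch degree below $f$ that has a representative with codomain $\mathbb N$. Let $\mathrm{TT}^1_2$ be the problem: given $c:2^{<\omega}\to\{0,1\}$, find a set $S\subseteq 2^{<\omega}$ (given by its characteristic function) on which $c$ is constant and which is a copy of the full binary tree. Here "copy" may be read in either of two ways: $S$ is isomorphic to $2^{<\omega}$ with respect to the order of extension, or with respect to the two relations "is in the left subtree below" and "is in the right subtree below". Let $\mathrm{RT}^1_+$ be the problem: given $k\in\mathbb N$ and $c:\mathbb N\to\{0,\dots,k-1\}$, find $i<k$ such that $c^{-1}(i)$ is infinite. A problem $f:\subseteq\mathbf X\rightrightarrows\mathbf Y$ is finitely guessable if there is a computable procedure that, given $x\in\operatorname{dom}(f)$, produces a finite tuple $(y_0,\dots,y_\ell)$ over the completion $\overline{\mathbf Y}=\mathbf Y\cup\{\bot\}$ (the length of the tuple being announced as part of the output, and individual entries possibly remaining undefined, i.e. $\bot$) such that $y_i\in f(x)$ for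 some $i\leq\ell$. **Proposition.** For both readings of $\mathrm{TT}^1_2$, the first-order part ${}^1(\mathrm{TT}^1_2)$ exists, ${}^1(\mathrm{TT}^1_2)\leq_{\mathrm W}\mathrm{RT}^1_+$, and ${}^1(\mathrm{TT}^1_2)$ is finitely guessable; that is, every problem in this Weihrauch degree is Weihrauch reducible to $\mathrm{RT}^1_+$ and is finitely guessable. -/

import Mathlib

namespace Weihrauch

/-! ### Computability on Baire space -/

/-- The finite initial segment `p(0), …, p(n-1)` of a sequence. -/
def initSeg (p : ℕ → ℕ) (n : ℕ) : List ℕ := (List.range n).map p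

/-- The word function `h` sends the input `p` to the output `q`: every finite initial segment of
`q` is produced by `h` from some finite initial segment of `p`. For monotone `h` there is at most
one such `q`. -/
def Produces (h : List ℕ → List ℕ) (p q : ℕ → ℕ) : Prop :=
  ∀ n, ∃ m, initSeg q n <+: h (initSeg p m)

/-- A partial function on Baire space is computable if, on its domain, it is given by a computable
monotone word function. -/
def BaireComputable (F : (ℕ → ℕ) →. (ℕ → ℕ)) : Prop :=
  ∃ h : List ℕ → List ℕ, Computable h ∧ (∀ σ τ, σ <+: τ → h σ <+: h τ) ∧
    ∀ p q, q ∈ F p → Produces h p q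

/-- The pairing `⟨p, q⟩` of sequences: `p` on the even and `q` on the odd positions. -/
def join (p q : ℕ → ℕ) : ℕ → ℕ := fun n => if n % 2 = 0 then p (n / 2) else q (n / 2)

/-! ### Represented spaces -/

/-- A representation of `X` is a partial surjection from Baire space onto `X`, given here by its
graph: `Names p x` says that `p` is a name of `x`. -/
class RepresentedSpace (X : Type) where
  Names : (ℕ → ℕ) → X → Prop
  names_unique : ∀ p x y, Names p x → Names p y → x = y
  exists_name : ∀ x, ∃ p, Names p x

open RepresentedSpace

/-- `p` names `n : ℕ` iff `p(0) = n`. -/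
instance : RepresentedSpace ℕ where
  Names p n := p 0 = n
  names_unique := fun _ _ _ h h' => h.symm.trans h'
  exists_name := fun n => ⟨fun _ => n, rfl⟩

/-- The completion of a represented space: a further point `⊥ = none` is added. -/
abbrev Completion (Y : Type) := Option Y

/-- The symbols of `p` that are not `0`, each decreased by `1`. It is an infinite sequence if
`p` has infinitely many nonzero symbols, and is used only in this case. -/
noncomputable def undelay (p : ℕ → ℕ) : ℕ → ℕ :=
  fun n => p (Nat.nth (fun i => p i ≠ 0) n) - 1

/-- `p` is a delayed name of `y`. -/
def DelayedName {Y : Type} [RepresentedSpace Y] (p : ℕ → ℕ) (y : Y) : Prop :=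
  {i | p i ≠ 0}.Infinite ∧ Names (undelay p) y

/-- `p` names `y` in the completion iff deleting all `0`s from `p`, and decreasing all other
symbols by `1`, gives a name of `y`; every other `p` names `⊥`. -/
instance {Y : Type} [RepresentedSpace Y] : RepresentedSpace (Completion Y) where
  Names p o := match o with
    | some y => DelayedName p y
    | none => ∀ y : Y, ¬ DelayedName p y
  names_unique := by
    rintro p (_ | x) (_ | y) h h'
    · rfl
    · exact absurd h' (h y)
    · exact absurd h (h' x)
    · exact congrArg some (names_unique _ x y h.2 h'.2)
  exists_name := by
    rintro (_ | y)
    · refine ⟨fun _ => 0, fun y h => ?_⟩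
      have := h.1
      simp at this
    · obtain ⟨q, hq⟩ := exists_name y
      refine ⟨fun n => q n + 1, ?_, ?_⟩
      · have : {i | q i + 1 ≠ 0} = Set.univ := by ext; simp
        rw [this]
        exact Set.infinite_univ
      · have : undelay (fun n => q n + 1) = q := by
          funext n
          simp [undelay]
        rw [this]
        exact hq

/-- Finite tuples of arbitrary length: a name gives the length first, then (interleaved) a name of
each entry. -/
instance {Y : Type} [RepresentedSpace Y] : RepresentedSpace (List Y) where
  Names p l := p 0 = l.length ∧
    ∀ (i : ℕ) (hi : i < l.length), Names (fun j => p (Nat.pair i j + 1)) l[i]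
  names_unique := by
    intro p l l' h h'
    refine List.ext_getElem (h.1.symm.trans h'.1) fun i hi hi' => ?_
    exact names_unique _ _ _ (h.2 i hi) (h'.2 i hi')
  exists_name := by
    intro l
    choose f hf using fun y : Y => exists_name y
    refine ⟨fun n => match n with
      | 0 => l.length
      | k + 1 => if hi : (Nat.unpair k).1 < l.length
          then f (l[(Nat.unpair k).1]) (Nat.unpair k).2 else 0, rfl, fun i hi => ?_⟩
    simpa [hi] using hf l[i]

/-! ### Problems and Weihrauch reducibility -/

/-- A partial multivalued function from `X` to `Y`; its domain is the set of the `x` with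
`f x` nonempty. -/
abbrev Problem (X Y : Type) := X → Set Y

/-- `F` is a realizer of `f`. -/
def Realizes {X Y : Type} [RepresentedSpace X] [RepresentedSpace Y]
    (F : (ℕ → ℕ) →. (ℕ → ℕ)) (f : Problem X Y) : Prop :=
  ∀ p x, Names p x → (f x).Nonempty → ∃ q ∈ F p, ∃ y ∈ f x, Names q y

/-- A problem is computable if it has a computable realizer. -/
def ComputableProblem {X Y : Type} [RepresentedSpace X] [RepresentedSpace Y]
    (f : Problem X Y) : Prop :=
  ∃ F, BaireComputable F ∧ Realizes F f

/-- Weihrauch reducibility, with inner reduction witness `H` and outer reduction witness `K`. -/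
def Reducible {X Y Z V : Type} [RepresentedSpace X] [RepresentedSpace Y]
    [RepresentedSpace Z] [RepresentedSpace V] (f : Problem X Y) (g : Problem Z V) : Prop :=
  ∃ H K : (ℕ → ℕ) →. (ℕ → ℕ), BaireComputable H ∧ BaireComputable K ∧
    ∀ p x, Names p x → (f x).Nonempty →
      ∃ r ∈ H p, ∃ z, Names r z ∧ (g z).Nonempty ∧
        ∀ s, ∀ v ∈ g z, Names s v → ∃ q ∈ K (join p s), ∃ y ∈ f x, Names q y

infix:50 " ≤W " => Reducible

/-- `g` represents the first-order part of `f`, the greatest Weihrauch degree below `f` that has a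
representative with codomain `ℕ`. -/
def IsFirstOrderPart {X Y Z V : Type} [RepresentedSpace X] [RepresentedSpace Y]
    [RepresentedSpace Z] [RepresentedSpace V] (g : Problem X Y) (f : Problem Z V) : Prop :=
  g ≤W f ∧
  (∃ (U : Type) (_ : RepresentedSpace U) (g' : Problem U ℕ), g ≤W g' ∧ g' ≤W g) ∧
  ∀ (U : Type) [RepresentedSpace U] (h : Problem U ℕ), h ≤W f → h ≤W g

/-- The problem of producing a finite tuple over the completion of `Y` one of whose entries is a
solution of `f`. -/
def guess {X Y : Type} (f : Problem X Y) : Problem X (List (Completion Y)) :=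
  fun x => {l | ∃ y ∈ f x, some y ∈ l}

/-- Finite guessability. -/
def FinitelyGuessable {X Y : Type} [RepresentedSpace X] [RepresentedSpace Y]
    (f : Problem X Y) : Prop :=
  ComputableProblem (guess f)

/-! ### The pigeonhole principle -/

/-- A number `k` of colours together with a `k`-colouring of `ℕ`. -/
abbrev NatColouring := Σ k : ℕ, (ℕ → Fin k)

instance : RepresentedSpace NatColouring where
  Names p c := p 0 = c.1 ∧ ∀ n, p (n + 1) = c.2 n
  names_unique := by
    rintro p ⟨k, c⟩ ⟨k', c'⟩ ⟨h0, h⟩ ⟨h0', h'⟩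
    obtain rfl : k = k' := h0.symm.trans h0'
    have : c = c' := by
      funext n
      exact Fin.ext ((h n).symm.trans (h' n))
    rw [this]
  exists_name := fun c => ⟨fun n => match n with
    | 0 => c.1
    | n + 1 => c.2 n, rfl, fun _ => rfl⟩

/-- `RT¹₊`: given `k` and `c : ℕ → {0, …, k-1}`, find a colour that occurs infinitely often. -/
def RT1Plus : Problem NatColouring ℕ :=
  fun c => {i | {n | (c.2 n : ℕ) = i}.Infinite}

/-! ### The tree pigeonhole principle -/

/-- The vertices of the full binary tree `2^{<ω}`; the order of extension is `<+:`. -/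
abbrev Node := List Bool

instance {k : ℕ} : RepresentedSpace (Node → Fin k) where
  Names p c := ∀ σ, p (Encodable.encode σ) = c σ
  names_unique := fun _ _ _ h h' => funext fun σ => Fin.ext ((h σ).symm.trans (h' σ))
  exists_name := fun c => ⟨fun n => ((Encodable.decode (α := Node) n).map fun σ => (c σ : ℕ)).getD 0,
    fun σ => by simp⟩

open Classical in
/-- Sets of vertices are given by their characteristic functions. -/
noncomputable instance : RepresentedSpace (Set Node) where
  Names p S := ∀ σ, p (Encodable.encode σ) = if σ ∈ S then 1 else 0
  names_unique := by
    intro p S T h h'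
    ext σ
    have := (h σ).symm.trans (h' σ)
    by_cases h1 : σ ∈ S <;> by_cases h2 : σ ∈ T <;> simp_all
  exists_name := fun S =>
    ⟨fun n => ((Encodable.decode (α := Node) n).map fun σ => if σ ∈ S then 1 else 0).getD 0,
      fun σ => by simp⟩

/-- `S`, with the order of extension, is isomorphic to the full binary tree. -/
def IsTreeCopy (S : Set Node) : Prop :=
  ∃ e : Node → Node, Function.Injective e ∧ Set.range e = S ∧
    ∀ σ τ, σ <+: τ ↔ e σ <+: e τ

/-- `S`, with the two relations "`τ` is in the left subtree below `σ`" and "`τ` is in the right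
subtree below `σ`", is isomorphic to the full binary tree. -/
def IsLeftRightTreeCopy (S : Set Node) : Prop :=
  ∃ e : Node → Node, Function.Injective e ∧ Set.range e = S ∧
    ∀ (i : Bool) (σ τ : Node), (σ ++ [i]) <+: τ ↔ (e σ ++ [i]) <+: e τ

/-- `TT¹ₖ`: given a `k`-colouring of the full binary tree, find a monochromatic copy of it. -/
def TT1 (k : ℕ) : Problem (Node → Fin k) (Set Node) :=
  fun c => {S | IsTreeCopy S ∧ ∃ b, ∀ σ ∈ S, c σ = b}

/-- `TT¹ₖ` for copies that respect left and right. -/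
def TT1LeftRight (k : ℕ) : Problem (Node → Fin k) (Set Node) :=
  fun c => {S | IsLeftRightTreeCopy S ∧ ∃ b, ∀ σ ∈ S, c σ = b}

end Weihrauch

open Weihrauch

namespace Weihrauch

open RepresentedSpace

/-! ### Word functions -/

/-! The first-order part has a universal representative, `firstOrderPart`: an instance is an
instance of the tree problem together with a table that assigns a number to some initial segment of
every name of every solution. A table entry at a finite word `s` is a correct answer as soon as `s`
extends to a name of a monochromatic copy. If `s` describes a finite monochromatic set closed under
meets, this holds whenever its colour is somewhere dense above each of its ends
(`exists_isLeftRightTreeCopy`, `GoodAt.exists_copy`). Only left-right copies are ever built; they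
are copies in both readings, so one argument covers both problems.

Above every vertex, either a given colour is somewhere dense or the other one is dense. Hence a
search for a finite tree `s` of some colour `b` with a table entry succeeds. Whether `b` is
somewhere dense above the ends of `s` is undecidable, so above each end a second search looks for a
finite tree `t` of the other colour with a table entry. At each stage the two colours are compared
by how far they have been seen to be dense; a colour that wins infinitely often is somewhere dense.
An end votes against `b` at a stage if its `t` has been found and `b` wins at no end of `t`.

Colour each stage by the first end voting against `b`, or by one extra colour if there is none. If
the extra colour recurs, `b` is somewhere dense above all ends of `s`, and the entry at `s` is
correct (`somewhereDense_of_not_prefersOther`). If an end recurs, the other colour is somewhere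
dense above all ends of its `t`, and the entry at `t` is correct. The number of colours is known
once `s` is found, so this is an instance of `RT1Plus` (`firstOrderPart_reducible_RT1Plus`).

Whatever reduces to `RT1Plus` is finitely guessable: run the outer witness on every possible colour
(`finitelyGuessable_of_reducible`). -/

theorem initSeg_length (p : ℕ → ℕ) (n : ℕ) : (initSeg p n).length = n := by simp [initSeg]

theorem initSeg_getElem? (p : ℕ → ℕ) (m n : ℕ) :
    (initSeg p m)[n]? = if n < m then some (p n) else none := by
  unfold initSeg
  split_ifs with h <;> simp [h]

theorem initSeg_getElem?_eq_some {p : ℕ → ℕ} {m n a : ℕ} :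
    (initSeg p m)[n]? = some a ↔ n < m ∧ p n = a := by
  rw [initSeg_getElem?]
  split_ifs with h <;> simp [h]

theorem initSeg_take (p : ℕ → ℕ) {k m : ℕ} (h : k ≤ m) : (initSeg p m).take k = initSeg p k := by
  apply List.ext_getElem?
  intro i
  simp only [List.getElem?_take, initSeg_getElem?]
  split_ifs <;> first | rfl | omega

theorem initSeg_prefix (p : ℕ → ℕ) {k m : ℕ} (h : k ≤ m) : initSeg p k <+: initSeg p m := by
  rw [← initSeg_take p h]
  exact List.take_prefix _ _

theorem prefix_getElem?_eq_some {l l' : List ℕ} (h : l <+: l') {n a : ℕ} (hn : l[n]? = some a) :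
    l'[n]? = some a := by
  obtain ⟨t, rfl⟩ := h
  rw [List.getElem?_append_left (List.getElem?_eq_some_iff.1 hn).1, hn]

/-- The first value that is not `none` among `u 0, …, u n`. -/
def firstSome {α : Type} (u : ℕ → Option α) : ℕ → Option α
  | 0 => u 0
  | n + 1 => firstSome u n <|> u (n + 1)

theorem firstSome_mono {α : Type} {u : ℕ → Option α} {n m : ℕ} {a : α} (h : n ≤ m)
    (ha : firstSome u n = some a) : firstSome u m = some a := by
  induction h with
  | refl => exact ha
  | step _ ih => simp [firstSome, ih]

theorem exists_of_firstSome {α : Type} {u : ℕ → Option α} {n : ℕ} {a : α}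
    (ha : firstSome u n = some a) : ∃ m ≤ n, u m = some a ∧ ∀ k < m, u k = none := by
  induction n with
  | zero => exact ⟨0, le_rfl, ha, by simp⟩
  | succ n ih =>
    cases h : firstSome u n with
    | some b =>
      obtain ⟨m, hm, h1, h2⟩ := ih (by simpa [firstSome, h] using ha)
      exact ⟨m, by omega, h1, h2⟩
    | none =>
      refine ⟨n + 1, le_rfl, by simpa [firstSome, h] using ha, ?_⟩
      clear ih ha
      induction n with
      | zero =>
        intro k hk
        obtain rfl : k = 0 := by omega
        exact h
      | succ n ih =>
        have : firstSome u n = none ∧ u (n + 1) = none := by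
          simpa [firstSome] using h
        intro k hk
        rcases Nat.lt_succ_iff_lt_or_eq.1 hk with hk | rfl
        · exact ih this.1 k hk
        · exact this.2

theorem firstSome_isSome {α : Type} {u : ℕ → Option α} {n m : ℕ} {a : α} (h : n ≤ m)
    (ha : u n = some a) : ∃ b, firstSome u m = some b := by
  have : ∃ b, firstSome u n = some b := by
    cases n with
    | zero => exact ⟨a, ha⟩
    | succ n => cases h' : firstSome u n with
      | none => exact ⟨a, by simp [firstSome, h', ha]⟩
      | some b => exact ⟨b, by simp [firstSome, h']⟩
  obtain ⟨b, hb⟩ := this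
  exact ⟨b, firstSome_mono h hb⟩

theorem firstSome_congr {α : Type} {u v : ℕ → Option α} {n : ℕ} (h : ∀ m ≤ n, u m = v m) :
    firstSome u n = firstSome v n := by
  induction n with
  | zero => exact h 0 le_rfl
  | succ n ih => simp only [firstSome, ih fun m hm => h m (by omega), h (n + 1) le_rfl]

theorem firstSome_eq_of_first {α : Type} {u : ℕ → Option α} {n m : ℕ} {a : α} (h : m ≤ n)
    (ha : u m = some a) (hlt : ∀ k < m, u k = none) : firstSome u n = some a := by
  obtain ⟨b, hb⟩ := firstSome_isSome h ha
  obtain ⟨k, -, hk, hk'⟩ := exists_of_firstSome hb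
  rcases lt_trichotomy k m with h1 | rfl | h1
  · rw [hlt k h1] at hk; cases hk
  · rw [hb, ← hk, ha]
  · rw [hk' m h1] at ha; cases ha

theorem computable_firstSome {β α : Type} [Primcodable β] [Primcodable α] {u : β → ℕ → Option α}
    {f : β → ℕ} (hu : Computable₂ u) (hf : Computable f) :
    Computable fun b => firstSome (u b) (f b) := by
  have : Computable fun b => (Nat.rec (u b 0)
      (fun n r => Option.casesOn r (u b (n + 1)) some) (f b) : Option α) := by
    refine Computable.nat_rec (h := fun b x => Option.casesOn x.2 (u b (x.1 + 1)) some) hf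
      (hu.comp Computable.id (Computable.const 0)) ?_
    refine Computable.option_casesOn (o := fun x : β × ℕ × Option α => x.2.2)
      (Computable.snd.comp Computable.snd)
      (hu.comp Computable.fst (Computable.succ.comp (Computable.fst.comp Computable.snd))) ?_
    exact (Computable.option_some.comp Computable.snd).to₂
  refine this.of_eq fun b => ?_
  induction f b with
  | zero => rfl
  | succ n ih =>
    simp only [firstSome, ← ih]
    cases (Nat.rec (u b 0) (fun n r => Option.casesOn r (u b (n + 1)) some) n : Option α) <;> rfl

theorem primrec_firstSome {β α : Type} [Primcodable β] [Primcodable α] {u : β → ℕ → Option α}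
    {f : β → ℕ} (hu : Primrec₂ u) (hf : Primrec f) :
    Primrec fun b => firstSome (u b) (f b) := by
  have : Primrec fun b => (Nat.rec (u b 0) (fun n r => r <|> u b (n + 1)) (f b) : Option α) := by
    refine Primrec.nat_rec' (h := fun b x => x.2 <|> u b (x.1 + 1)) hf
      (hu.comp Primrec.id (Primrec.const 0)) ?_
    exact Primrec.option_orElse.comp (Primrec.snd.comp Primrec.snd)
      (hu.comp Primrec.fst (Primrec.succ.comp (Primrec.fst.comp Primrec.snd)))
  refine this.of_eq fun b => ?_
  induction f b with
  | zero => rfl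
  | succ n ih => simp only [firstSome, ← ih]

/-- The computable monotone word functions. -/
def WordFunction (h : List ℕ → List ℕ) : Prop :=
  Computable h ∧ ∀ σ τ, σ <+: τ → h σ <+: h τ

/-- The list `u 0, u 1, …` up to the first `none`, cut off after `n` entries. -/
def definedPart (u : ℕ → Option ℕ) : ℕ → List ℕ
  | 0 => []
  | n + 1 => if (definedPart u n).length = n then definedPart u n ++ (u n).toList
    else definedPart u n

theorem definedPart_length_le (u : ℕ → Option ℕ) (n : ℕ) : (definedPart u n).length ≤ n := by
  induction n with
  | zero => simp [definedPart]
  | succ n ih =>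
    simp only [definedPart]
    split_ifs
    · cases u n <;> simp <;> omega
    · omega

/-- After a missing entry the length stays behind the counter for good, so nothing is appended later
and the list cannot contain gaps. -/
theorem definedPart_prefix {u v : ℕ → Option ℕ} (h : ∀ n a, u n = some a → v n = some a)
    {n m : ℕ} (hnm : n ≤ m) : definedPart u n <+: definedPart v m := by
  have h1 : ∀ n, definedPart v n <+: definedPart v (n + 1) := by
    intro n
    simp only [definedPart]
    split_ifs
    · exact List.prefix_append _ _
    · exact List.prefix_rfl
  have h2 : ∀ n, definedPart u n <+: definedPart v n := by
    intro n
    induction n with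
    | zero => simp [definedPart]
    | succ n ih =>
      by_cases hl : (definedPart u n).length = n
      · have hl' : (definedPart v n).length = n :=
          le_antisymm (definedPart_length_le v n) (hl.symm.le.trans ih.length_le)
        have he : definedPart u n = definedPart v n := ih.eq_of_length (hl.trans hl'.symm)
        simp only [definedPart, hl', if_true, he]
        cases hu : u n with
        | none => simp
        | some a => simp [h n a hu]
      · simp only [definedPart, if_neg hl]
        exact ih.trans (h1 n)
  induction hnm with
  | refl => exact h2 n
  | step _ ih => exact ih.trans (h1 _)

theorem definedPart_eq_initSeg {u : ℕ → Option ℕ} {q : ℕ → ℕ} {n : ℕ}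
    (h : ∀ i < n, u i = some (q i)) : definedPart u n = initSeg q n := by
  induction n with
  | zero => rfl
  | succ n ih =>
    simp only [definedPart, ih fun i hi => h i (by omega), initSeg_length, if_true,
      h n (Nat.lt_succ_self n)]
    simp [initSeg, List.range_succ]

theorem computable_definedPart {β : Type} [Primcodable β] {u : β → ℕ → Option ℕ} {f : β → ℕ}
    (hu : Computable₂ u) (hf : Computable f) : Computable fun b => definedPart (u b) (f b) := by
  have : Computable fun b => (Nat.rec []
      (fun n (r : List ℕ) => bif decide (r.length = n) then r ++ (u b n).toList else r) (f b) :
        List ℕ) := by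
    refine Computable.nat_rec (h := fun b (x : ℕ × List ℕ) =>
      bif decide (x.2.length = x.1) then x.2 ++ (u b x.1).toList else x.2) hf
      (Computable.const []) ?_
    refine Computable.cond ?_ ?_ (Computable.snd.comp Computable.snd)
    · have : PrimrecPred fun x : β × ℕ × List ℕ => x.2.2.length = x.2.1 :=
        Primrec.eq.comp (Primrec.list_length.comp (Primrec.snd.comp Primrec.snd))
          (Primrec.fst.comp Primrec.snd)
      exact this.decide.to_comp
    · exact Computable.list_append.comp (Computable.snd.comp Computable.snd)
        (Primrec.optionToList.to_comp.comp
          (hu.comp Computable.fst (Computable.fst.comp Computable.snd)))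
  refine this.of_eq fun b => ?_
  induction f b with
  | zero => rfl
  | succ n ih =>
    simp only [definedPart, ← ih, Bool.cond_decide]

/-- A word function may be given by a procedure that computes the `n`-th output symbol, or
`none`, from a finite initial segment of the input; the first answer counts. -/
theorem exists_wordFunction {u : List ℕ → ℕ → Option ℕ} (hu : Computable₂ u) :
    ∃ h, WordFunction h ∧ ∀ p q,
      (∀ n, ∃ m, u (initSeg p m) n = some (q n) ∧ ∀ k < m, u (initSeg p k) n = none) →
      Produces h p q := by
  -- Consulting all prefixes of the input in order makes an answer permanent, although `u` itself
  -- need not be monotone.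
  refine ⟨fun σ => definedPart (fun n => firstSome (fun m => u (σ.take m) n) σ.length) σ.length,
    ⟨?_, ?_⟩, ?_⟩
  · refine computable_definedPart (u := fun σ n => firstSome (fun m => u (σ.take m) n) σ.length)
      ?_ Computable.list_length
    refine computable_firstSome (β := List ℕ × ℕ) (u := fun x m => u (x.1.take m) x.2)
      (f := fun x => x.1.length) ?_
      (Computable.list_length.comp Computable.fst)
    exact hu.comp (Primrec.list_take.to_comp.comp Computable.snd
      (Computable.fst.comp Computable.fst)) (Computable.snd.comp Computable.fst)
  · intro σ τ hστ
    refine definedPart_prefix (fun n a ha => ?_) hστ.length_le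
    refine firstSome_mono hστ.length_le ?_
    rw [← ha]
    refine firstSome_congr fun m hm => ?_
    obtain ⟨t, rfl⟩ := hστ
    rw [List.take_append_of_le_length hm]
  · intro p q h n
    choose m hm hm' using h
    obtain ⟨N, hN⟩ : ∃ N, n ≤ N ∧ ∀ i < n, m i ≤ N := by
      refine ⟨n + ∑ i ∈ Finset.range n, m i, by omega, fun i hi => ?_⟩
      have := Finset.single_le_sum (f := m) (fun _ _ => Nat.zero_le _) (Finset.mem_range.2 hi)
      omega
    refine ⟨N, ?_⟩
    simp only [initSeg_length]
    rw [← definedPart_eq_initSeg (u := fun n =>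
      firstSome (fun m => u ((initSeg p N).take m) n) N) (n := n)]
    · exact definedPart_prefix (fun _ _ h => h) hN.1
    · intro i hi
      refine firstSome_eq_of_first (hN.2 i hi) ?_ ?_
      · rw [initSeg_take p (hN.2 i hi)]
        exact hm i
      · intro k hk
        rw [initSeg_take p (hk.le.trans (hN.2 i hi))]
        exact hm' i k hk

/-- The condition on the procedure is met if answers exist and are always correct. -/
theorem exists_wordFunction_of_sound {u : List ℕ → ℕ → Option ℕ} (hu : Computable₂ u) :
    ∃ h, WordFunction h ∧ ∀ p q, (∀ n, ∃ m, (u (initSeg p m) n).isSome) →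
      (∀ n m a, u (initSeg p m) n = some a → a = q n) → Produces h p q := by
  obtain ⟨h, hw, hh⟩ := exists_wordFunction hu
  refine ⟨h, hw, fun p q h1 h2 => hh p q fun n => ?_⟩
  classical
  refine ⟨Nat.find (h1 n), ?_, fun k hk => ?_⟩
  · obtain ⟨a, ha⟩ := Option.isSome_iff_exists.1 (Nat.find_spec (h1 n))
    rw [ha, h2 n _ a ha]
  · simpa using Nat.find_min (h1 n) hk

/-- By monotonicity, the outputs on two initial segments of `p` are both prefixes of the output on
the longer one. -/
theorem Produces.getElem? {h : List ℕ → List ℕ} (hw : WordFunction h) {p q : ℕ → ℕ}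
    (hp : Produces h p q) {m n a : ℕ} (ha : (h (initSeg p m))[n]? = some a) : q n = a := by
  obtain ⟨m', hm'⟩ := hp (n + 1)
  have h1 : (h (initSeg p (max m m')))[n]? = some (q n) :=
    prefix_getElem?_eq_some (hm'.trans (hw.2 _ _ (initSeg_prefix p (le_max_right _ _))))
      (initSeg_getElem?_eq_some.2 ⟨Nat.lt_succ_self n, rfl⟩)
  have h2 := prefix_getElem?_eq_some (hw.2 _ _ (initSeg_prefix p (le_max_left m m'))) ha
  exact Option.some_injective _ (h1.symm.trans h2)

theorem Produces.exists_getElem? {h : List ℕ → List ℕ} {p q : ℕ → ℕ} (hp : Produces h p q)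
    (n : ℕ) : ∃ m, (h (initSeg p m))[n]? = some (q n) := by
  obtain ⟨m, hm⟩ := hp (n + 1)
  exact ⟨m, prefix_getElem?_eq_some hm (initSeg_getElem?_eq_some.2 ⟨Nat.lt_succ_self n, rfl⟩)⟩

theorem Produces.unique {h : List ℕ → List ℕ} (hw : WordFunction h) {p q q' : ℕ → ℕ}
    (hq : Produces h p q) (hq' : Produces h p q') : q = q' := by
  funext n
  obtain ⟨m, hm⟩ := hq'.exists_getElem? n
  exact hq.getElem? hw hm

theorem WordFunction.comp {h h' : List ℕ → List ℕ} (hw : WordFunction h) (hw' : WordFunction h') :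
    WordFunction (h' ∘ h) :=
  ⟨hw'.1.comp hw.1, fun _ _ hs => hw'.2 _ _ (hw.2 _ _ hs)⟩

theorem Produces.comp {h h' : List ℕ → List ℕ} (hw' : WordFunction h') {p q r : ℕ → ℕ}
    (hp : Produces h p q) (hq : Produces h' q r) : Produces (h' ∘ h) p r := by
  intro n
  obtain ⟨m, hm⟩ := hq n
  obtain ⟨k, hk⟩ := hp m
  exact ⟨k, hm.trans (hw'.2 _ _ hk)⟩

theorem primrec_mod_two : Primrec fun n : ℕ => n % 2 :=
  Primrec.nat_mod.comp Primrec.id (Primrec.const 2)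

theorem primrec_div_two : Primrec fun n : ℕ => n / 2 :=
  Primrec.nat_div.comp Primrec.id (Primrec.const 2)

theorem primrec_double : Primrec fun n : ℕ => 2 * n :=
  Primrec.nat_mul.comp (Primrec.const 2) Primrec.id

theorem exists_wordFunction_join {h h' : List ℕ → List ℕ} (hw : WordFunction h)
    (hw' : WordFunction h') : ∃ k, WordFunction k ∧ ∀ p q q', Produces h p q →
      Produces h' p q' → Produces k p (join q q') := by
  have hu : Computable₂ fun (σ : List ℕ) (n : ℕ) =>
      bif decide (n % 2 = 0) then (h σ)[n / 2]? else (h' σ)[n / 2]? := by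
    have h2 : Computable fun x : List ℕ × ℕ => x.2 / 2 := primrec_div_two.to_comp.comp Computable.snd
    refine Computable.cond ?_ (Computable.list_getElem?.comp (hw.1.comp Computable.fst) h2)
      (Computable.list_getElem?.comp (hw'.1.comp Computable.fst) h2)
    have : PrimrecPred fun x : List ℕ × ℕ => x.2 % 2 = 0 :=
      Primrec.eq.comp (primrec_mod_two.comp Primrec.snd) (Primrec.const 0)
    exact this.decide.to_comp
  obtain ⟨k, hk, hk'⟩ := exists_wordFunction_of_sound hu
  refine ⟨k, hk, fun p q q' hq hq' => hk' p _ (fun n => ?_) fun n m a ha => ?_⟩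
  · by_cases hn : n % 2 = 0
    · obtain ⟨m, hm⟩ := hq.exists_getElem? (n / 2)
      exact ⟨m, by simp [hn, hm]⟩
    · obtain ⟨m, hm⟩ := hq'.exists_getElem? (n / 2)
      exact ⟨m, by simp [hn, hm]⟩
  · by_cases hn : n % 2 = 0
    · simp only [hn, decide_true, cond_true] at ha
      simpa [join, hn] using (hq.getElem? hw ha).symm
    · simp only [hn, decide_false, cond_false] at ha
      simpa [join, hn] using (hq'.getElem? hw' ha).symm

theorem join_even (p q : ℕ → ℕ) (n : ℕ) : join p q (2 * n) = p n := by simp [join]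

theorem join_odd (p q : ℕ → ℕ) (n : ℕ) : join p q (2 * n + 1) = q n := by
  have h1 : (2 * n + 1) % 2 ≠ 0 := by omega
  have h2 : (2 * n + 1) / 2 = n := by omega
  simp [join, h2]

/-- A primitive recursive rearrangement of the input. -/
theorem exists_wordFunction_select {f : ℕ → ℕ} (hf : Primrec f) :
    ∃ h, WordFunction h ∧ ∀ p, Produces h p fun n => p (f n) := by
  have hu : Computable₂ fun (σ : List ℕ) (n : ℕ) => σ[f n]? :=
    Computable.list_getElem?.comp Computable.fst (hf.to_comp.comp Computable.snd)
  obtain ⟨h, hw, hh⟩ := exists_wordFunction_of_sound hu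
  refine ⟨h, hw, fun p => hh p _ (fun n => ⟨f n + 1, ?_⟩) fun n m a ha => ?_⟩
  · simp [initSeg_getElem?]
  · exact (initSeg_getElem?_eq_some.1 ha).2.symm

theorem exists_wordFunction_fst :
    ∃ h, WordFunction h ∧ ∀ p q, Produces h (join p q) p := by
  obtain ⟨h, hw, hh⟩ := exists_wordFunction_select primrec_double
  refine ⟨h, hw, fun p q => ?_⟩
  simpa only [join_even] using hh (join p q)

theorem exists_wordFunction_snd :
    ∃ h, WordFunction h ∧ ∀ p q, Produces h (join p q) q := by
  obtain ⟨h, hw, hh⟩ := exists_wordFunction_select (Primrec.succ.comp primrec_double)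
  refine ⟨h, hw, fun p q => ?_⟩
  simpa only [Nat.succ_eq_add_one, join_odd] using hh (join p q)

/-- The largest partial function that is computed by a word function. -/
noncomputable def wordPFun (h : List ℕ → List ℕ) : (ℕ → ℕ) →. (ℕ → ℕ) :=
  fun p => ⟨∃ q, Produces h p q, fun hq => hq.choose⟩

theorem produces_of_mem_wordPFun {h : List ℕ → List ℕ} {p q : ℕ → ℕ} (hq : q ∈ wordPFun h p) :
    Produces h p q := by
  obtain ⟨h1, h2⟩ := hq
  exact h2 ▸ h1.choose_spec

theorem mem_wordPFun {h : List ℕ → List ℕ} (hw : WordFunction h) {p q : ℕ → ℕ}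
    (hq : Produces h p q) : q ∈ wordPFun h p :=
  ⟨⟨q, hq⟩, (Exists.choose_spec (p := fun q => Produces h p q) ⟨q, hq⟩).unique hw hq⟩

theorem baireComputable_wordPFun {h : List ℕ → List ℕ} (hw : WordFunction h) :
    BaireComputable (wordPFun h) :=
  ⟨h, hw.1, hw.2, fun _ _ hq => produces_of_mem_wordPFun hq⟩

/-! ### Weihrauch reductions by word functions -/

section

variable {X Y Z V : Type} [RepresentedSpace X] [RepresentedSpace Y] [RepresentedSpace Z]
  [RepresentedSpace V]

/-- Replacing a witness by the largest partial function its word function computes only extends it,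
so reductions can be handled by word functions alone. -/
theorem reducible_iff {f : Problem X Y} {g : Problem Z V} :
    f ≤W g ↔ ∃ h k, WordFunction h ∧ WordFunction k ∧
      ∀ p x, Names p x → (f x).Nonempty →
        ∃ r, Produces h p r ∧ ∃ z, Names r z ∧ (g z).Nonempty ∧
          ∀ s, ∀ v ∈ g z, Names s v → ∃ q, Produces k (join p s) q ∧ ∃ y ∈ f x, Names q y := by
  constructor
  · rintro ⟨H, K, ⟨h, hc, hm, hh⟩, ⟨k, kc, km, kk⟩, hHK⟩
    refine ⟨h, k, ⟨hc, hm⟩, ⟨kc, km⟩, fun p x hp hx => ?_⟩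
    obtain ⟨r, hr, z, hz, hn, hs⟩ := hHK p x hp hx
    refine ⟨r, hh p r hr, z, hz, hn, fun s v hv hsv => ?_⟩
    obtain ⟨q, hq, hy⟩ := hs s v hv hsv
    exact ⟨q, kk _ _ hq, hy⟩
  · rintro ⟨h, k, hw, kw, hhk⟩
    refine ⟨wordPFun h, wordPFun k, baireComputable_wordPFun hw, baireComputable_wordPFun kw,
      fun p x hp hx => ?_⟩
    obtain ⟨r, hr, z, hz, hn, hs⟩ := hhk p x hp hx
    refine ⟨r, mem_wordPFun hw hr, z, hz, hn, fun s v hv hsv => ?_⟩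
    obtain ⟨q, hq, hy⟩ := hs s v hv hsv
    exact ⟨q, mem_wordPFun kw hq, hy⟩

theorem computableProblem_of_wordFunction {f : Problem X Y} {h : List ℕ → List ℕ}
    (hw : WordFunction h) (hh : ∀ p x, Names p x → (f x).Nonempty →
      ∃ q, Produces h p q ∧ ∃ y ∈ f x, Names q y) : ComputableProblem f := by
  refine ⟨wordPFun h, baireComputable_wordPFun hw, fun p x hp hx => ?_⟩
  obtain ⟨q, hq, hy⟩ := hh p x hp hx
  exact ⟨q, mem_wordPFun hw hq, hy⟩

/-- The composed outer witness keeps the original input and recomputes the intermediate instance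
from it. -/
theorem Reducible.trans {A B : Type} [RepresentedSpace A] [RepresentedSpace B]
    {f : Problem X Y} {g : Problem Z V} {k : Problem A B} (hfg : f ≤W g) (hgk : g ≤W k) :
    f ≤W k := by
  obtain ⟨h₁, k₁, hw₁, kw₁, H₁⟩ := reducible_iff.1 hfg
  obtain ⟨h₂, k₂, hw₂, kw₂, H₂⟩ := reducible_iff.1 hgk
  obtain ⟨π₁, πw₁, hπ₁⟩ := exists_wordFunction_fst
  obtain ⟨π₂, πw₂, hπ₂⟩ := exists_wordFunction_snd
  obtain ⟨j, jw, hj⟩ := exists_wordFunction_join (πw₁.comp hw₁) πw₂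
  obtain ⟨j', jw', hj'⟩ := exists_wordFunction_join πw₁ (jw.comp kw₂)
  refine reducible_iff.2 ⟨h₂ ∘ h₁, k₁ ∘ j', hw₁.comp hw₂, jw'.comp kw₁, fun p x hp hx => ?_⟩
  obtain ⟨r, hr, z, hz, hn, hs⟩ := H₁ p x hp hx
  obtain ⟨r', hr', a, ha, hn', hs'⟩ := H₂ r z hz hn
  refine ⟨r', hr.comp hw₂ hr', a, ha, hn', fun s b hb hsb => ?_⟩
  obtain ⟨t, ht, v, hv, htv⟩ := hs' s b hb hsb
  obtain ⟨q, hq, hy⟩ := hs t v hv htv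
  refine ⟨q, Produces.comp kw₁ (hj' _ _ _ (hπ₁ p s) (Produces.comp kw₂ (hj _ _ _
    ((hπ₁ p s).comp hw₁ hr) (hπ₂ p s)) ht)) hq, hy⟩

end

/-! ### Copies of the full binary tree -/

theorem exists_split {σ τ : Node} (h : ¬ σ <+: τ) (h' : ¬ τ <+: σ) :
    ∃ μ i, μ ++ [i] <+: σ ∧ μ ++ [!i] <+: τ := by
  induction σ generalizing τ with
  | nil => exact absurd List.nil_prefix h
  | cons a σ ih =>
    cases τ with
    | nil => exact absurd List.nil_prefix h'
    | cons b τ =>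
      by_cases hab : a = b
      · subst hab
        rw [List.cons_prefix_cons] at h h'
        obtain ⟨μ, i, h1, h2⟩ := ih (fun hh => h ⟨rfl, hh⟩) (fun hh => h' ⟨rfl, hh⟩)
        exact ⟨a :: μ, i, by simpa using h1, by simpa using h2⟩
      · refine ⟨[], a, by simp, ?_⟩
        have : b = !a := by cases a <;> cases b <;> simp_all
        simp [this]

theorem not_split {μ σ : Node} {i : Bool} (h : μ ++ [i] <+: σ) (h' : μ ++ [!i] <+: σ) : False := by
  have := (List.prefix_of_prefix_length_le h h' (by simp)).eq_of_length (by simp)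
  simp at this

theorem split_unique {μ ν σ τ : Node} {i j : Bool} (h1 : μ ++ [i] <+: σ) (h2 : μ ++ [!i] <+: τ)
    (h3 : ν ++ [j] <+: σ) (h4 : ν ++ [!j] <+: τ) : μ = ν := by
  have key : ∀ {μ ν σ τ : Node} {i j : Bool}, μ ++ [i] <+: σ → μ ++ [!i] <+: τ →
      ν ++ [j] <+: σ → ν ++ [!j] <+: τ → ν.length ≤ μ.length := by
    intro μ ν σ τ i j h1 h2 h3 h4
    by_contra! hlt
    have hσ : μ ++ [i] <+: ν := List.prefix_of_prefix_length_le h1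
      ((List.prefix_append _ _).trans h3) (by simpa using hlt)
    have hτ : μ ++ [!i] <+: ν := List.prefix_of_prefix_length_le h2
      ((List.prefix_append _ _).trans h4) (by simpa using hlt)
    exact not_split hσ hτ
  have hl := le_antisymm (key h3 h4 h1 h2) (key h1 h2 h3 h4)
  exact (List.prefix_of_prefix_length_le ((List.prefix_append _ _).trans h1)
    ((List.prefix_append _ _).trans h3) hl.le).eq_of_length hl

theorem exists_append_singleton_prefix {σ τ : Node} (h : σ <+: τ) (hne : σ ≠ τ) :
    ∃ i, σ ++ [i] <+: τ := by
  obtain ⟨t, rfl⟩ := h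
  cases t with
  | nil => simp at hne
  | cons i t => exact ⟨i, t, by simp⟩

theorem not_append_singleton_prefix (σ : Node) (i : Bool) : ¬ σ ++ [i] <+: σ := fun h => by
  simpa using h.length_le

theorem prefix_map_of_step {e : Node → Node} (he : ∀ σ i, e σ ++ [i] <+: e (σ ++ [i]))
    {σ τ : Node} (h : σ <+: τ) : e σ <+: e τ := by
  obtain ⟨t, rfl⟩ := h
  induction t using List.reverseRecOn with
  | nil => simp
  | append_singleton t i ih =>
    rw [← List.append_assoc]
    exact ih.trans ((List.prefix_append _ _).trans (he _ i))

/-- The step condition propagates along paths, so left and right are preserved. They are also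
reflected: in any other relative position of `σ` and `τ`, preservation puts the images in a position
incompatible with the assumed one. -/
theorem isLeftRightTreeCopy_of_step {e : Node → Node}
    (he : ∀ σ i, e σ ++ [i] <+: e (σ ++ [i])) : IsLeftRightTreeCopy (Set.range e) := by
  have h1 : ∀ {i σ τ}, σ ++ [i] <+: τ → e σ ++ [i] <+: e τ := fun h =>
    (he _ _).trans (prefix_map_of_step he h)
  have h2 : ∀ {σ τ}, σ ≠ τ → ¬ (∃ i, e σ ++ [i] <+: e τ ∧ ¬ σ ++ [i] <+: τ) ∧ e σ ≠ e τ := by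
    intro σ τ hne
    by_cases hστ : σ <+: τ
    · obtain ⟨j, hj⟩ := exists_append_singleton_prefix hστ hne
      refine ⟨?_, fun heq => not_append_singleton_prefix _ _ (heq ▸ h1 hj)⟩
      rintro ⟨i, hi, hi'⟩
      have : i ≠ j := by rintro rfl; exact hi' hj
      obtain rfl : j = !i := by cases i <;> cases j <;> simp_all
      exact not_split hi (h1 hj)
    by_cases hτσ : τ <+: σ
    · obtain ⟨j, hj⟩ := exists_append_singleton_prefix hτσ hne.symm
      refine ⟨?_, fun heq => not_append_singleton_prefix _ _ (heq ▸ h1 hj)⟩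
      rintro ⟨i, hi, -⟩
      have h3 := hi.length_le
      have h4 := (h1 hj).length_le
      simp at h3 h4
      omega
    obtain ⟨μ, j, h3, h4⟩ := exists_split hστ hτσ
    refine ⟨?_, fun heq => not_split (h1 h3) (heq ▸ h1 h4)⟩
    rintro ⟨i, hi, -⟩
    exact not_split ((h1 h3).trans ((List.prefix_append _ _).trans hi)) (h1 h4)
  refine ⟨e, fun σ τ h => ?_, rfl, fun i σ τ => ⟨h1, fun h => ?_⟩⟩
  · by_contra hne
    exact (h2 hne).2 h
  · by_contra hn
    by_cases hne : σ = τ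
    · subst hne
      exact not_append_singleton_prefix _ _ h
    · exact (h2 hne).1 ⟨i, h, hn⟩

theorem IsLeftRightTreeCopy.isTreeCopy {S : Set Node} (h : IsLeftRightTreeCopy S) :
    IsTreeCopy S := by
  obtain ⟨e, hi, hr, he⟩ := h
  have key : ∀ σ τ : Node, σ <+: τ ↔ σ = τ ∨ ∃ i, σ ++ [i] <+: τ := by
    intro σ τ
    constructor
    · intro h
      by_cases hne : σ = τ
      · exact Or.inl hne
      · exact Or.inr (exists_append_singleton_prefix h hne)
    · rintro (rfl | ⟨i, h⟩)
      · exact List.prefix_rfl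
      · exact (List.prefix_append _ _).trans h
  refine ⟨e, hi, hr, fun σ τ => ?_⟩
  rw [key σ τ, key (e σ) (e τ), hi.eq_iff]
  exact or_congr_right (exists_congr fun i => he i σ τ)

/-- The preimages branch at some `ν`, and `e ν` is a branching point of the images; branching points
are unique. A copy for the order alone may omit meets. -/
theorem IsLeftRightTreeCopy.mem_of_split {S : Set Node} (h : IsLeftRightTreeCopy S)
    {μ σ τ : Node} (hσ : σ ∈ S) (hτ : τ ∈ S) (h1 : μ ++ [false] <+: σ) (h2 : μ ++ [true] <+: τ) :
    μ ∈ S := by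
  obtain ⟨e, hi, rfl, he⟩ := h
  obtain ⟨a, rfl⟩ := hσ
  obtain ⟨b, rfl⟩ := hτ
  have hmono : ∀ {x y}, x <+: y → e x <+: e y := by
    intro x y hxy
    by_cases hne : x = y
    · rw [hne]
    · obtain ⟨i, hi⟩ := exists_append_singleton_prefix hxy hne
      exact (List.prefix_append _ _).trans ((he i x y).1 hi)
  by_cases hab : a <+: b
  · exact (not_split (i := false) (h1.trans (hmono hab)) h2).elim
  by_cases hba : b <+: a
  · exact (not_split (i := false) h1 (h2.trans (hmono hba))).elim
  obtain ⟨ν, i, h3, h4⟩ := exists_split hab hba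
  exact ⟨ν, split_unique ((he _ _ _).1 h3) ((he _ _ _).1 h4) (j := false) h1 h2⟩

/-- `P` is dense in some cone above `ρ`. -/
def SomewhereDense (P : Set Node) (ρ : Node) : Prop :=
  ∃ τ, ρ <+: τ ∧ ∀ υ, τ <+: υ → ∃ υ', υ <+: υ' ∧ υ' ∈ P

theorem SomewhereDense.of_prefix {P : Set Node} {ρ ρ' : Node} (h : ρ <+: ρ')
    (hd : SomewhereDense P ρ') : SomewhereDense P ρ := by
  obtain ⟨τ, hτ, hP⟩ := hd
  exact ⟨τ, h.trans hτ, hP⟩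

theorem somewhereDense_or_compl (P : Set Node) (ρ : Node) :
    SomewhereDense P ρ ∨ ∀ τ, ρ <+: τ → ∃ υ, τ <+: υ ∧ ∀ υ', υ <+: υ' → υ' ∈ Pᶜ := by
  by_contra! h
  obtain ⟨h1, τ, hτ, h2⟩ := h
  refine h1 ⟨τ, hτ, fun υ hυ => ?_⟩
  obtain ⟨υ', h3, h4⟩ := h2 υ hυ
  exact ⟨υ', h3, by simpa using h4⟩

theorem SomewhereDense.exists_mem {P : Set Node} {ρ : Node} (h : SomewhereDense P ρ) (N : ℕ) :
    ∃ σ, ρ <+: σ ∧ σ ∈ P ∧ N ≤ σ.length ∧ ∀ i, SomewhereDense P (σ ++ [i]) := by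
  obtain ⟨τ, hτ, hP⟩ := h
  -- The padding forces length at least `N` while staying in the cone where `P` is dense.
  obtain ⟨σ, h1, h2⟩ := hP (τ ++ List.replicate N false) (List.prefix_append _ _)
  have h3 : τ <+: σ := (List.prefix_append _ _).trans h1
  refine ⟨σ, hτ.trans h3, h2, ?_, fun i => ⟨σ ++ [i], List.prefix_rfl, fun υ hυ =>
    hP υ (h3.trans ((List.prefix_append _ _).trans hυ))⟩⟩
  have := h1.length_le
  simp at this
  omega

/-- A set of vertices that is closed under meets, consists of elements of `P` above `ρ` and can be
extended above each of its elements, is extended to a copy of the full binary tree without adding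
vertices of length below `N`. -/
theorem exists_isLeftRightTreeCopy {P F : Set Node} {ρ : Node} (N : ℕ)
    (hρ : SomewhereDense P ρ) (hF : ∀ σ ∈ F, ρ <+: σ ∧ σ ∈ P ∧ ∀ i, SomewhereDense P (σ ++ [i]))
    (hmeet : ∀ σ ∈ F, ∀ τ ∈ F, ∀ μ, μ ++ [false] <+: σ → μ ++ [true] <+: τ → μ ∈ F) :
    ∃ S, IsLeftRightTreeCopy S ∧ F ⊆ S ∧ ∀ σ ∈ S, ρ <+: σ ∧ σ ∈ P ∧ (N ≤ σ.length ∨ σ ∈ F) := by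
  have hmeet' : ∀ σ ∈ F, ∀ τ ∈ F, ∀ μ i, μ ++ [i] <+: σ → μ ++ [!i] <+: τ → μ ∈ F := by
    rintro σ hσ τ hτ μ (_ | _) h1 h2
    · exact hmeet σ hσ τ hτ μ h1 h2
    · exact hmeet τ hτ σ hσ μ h2 h1
  -- If `F` meets the cone above `τ`, pick its shortest element there. It lies below all the others,
  -- since branching off from one of them would put a shorter meet into `F`. Otherwise pick a long
  -- element of `P`.
  have hpick : ∀ τ, SomewhereDense P τ → ∃ x, τ <+: x ∧ (ρ <+: τ → ρ <+: x ∧ x ∈ P) ∧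
      (∀ i, SomewhereDense P (x ++ [i])) ∧ (N ≤ x.length ∨ x ∈ F) ∧
      ∀ f ∈ F, τ <+: f → x ∈ F ∧ x <+: f := by
    intro τ hτ
    by_cases hex : ∃ n, ∃ f ∈ F, τ <+: f ∧ f.length = n
    · classical
      obtain ⟨x, hx, hτx, hlen⟩ := Nat.find_spec hex
      refine ⟨x, hτx, fun h => ⟨h.trans hτx, (hF x hx).2.1⟩, (hF x hx).2.2, Or.inr hx,
        fun f hf hτf => ⟨hx, ?_⟩⟩
      have hmin : ∀ g ∈ F, τ <+: g → x.length ≤ g.length := fun g hg hτg => by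
        rw [hlen]
        exact Nat.find_min' hex ⟨g, hg, hτg, rfl⟩
      by_contra hxf
      have hfx : ¬ f <+: x := fun h => by
        have := h.eq_of_length (le_antisymm h.length_le (hmin f hf hτf))
        exact hxf (this ▸ List.prefix_rfl)
      obtain ⟨μ, i, h1, h2⟩ := exists_split hxf hfx
      have hμ := hmeet' x hx f hf μ i h1 h2
      have hμx : μ.length < x.length := by simpa using h1.length_le
      have hτμ : τ <+: μ := by
        by_contra hτμ
        have hlt : μ.length < τ.length := by
          by_contra! hle
          exact hτμ (List.prefix_of_prefix_length_le hτx ((List.prefix_append _ _).trans h1) hle)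
        exact not_split (List.prefix_of_prefix_length_le h1 hτx (by simpa using hlt))
          (List.prefix_of_prefix_length_le h2 hτf (by simpa using hlt))
      exact absurd (hmin μ hμ hτμ) (by omega)
    · push Not at hex
      obtain ⟨x, h1, h2, h3, h4⟩ := hτ.exists_mem N
      exact ⟨x, h1, fun h => ⟨h.trans h1, h2⟩, h4, Or.inl h3,
        fun f hf hτf => absurd rfl (hex _ f hf hτf)⟩
  choose! pick hp1 hp2 hp3 hp4 hp5 using hpick
  set e : Node → Node := fun σ => σ.foldl (fun x i => pick (x ++ [i])) (pick ρ) with he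
  have estep : ∀ σ i, e (σ ++ [i]) = pick (e σ ++ [i]) := fun σ i => by simp [he]
  have hsd : ∀ σ i, SomewhereDense P (e σ ++ [i]) := by
    intro σ
    induction σ using List.reverseRecOn with
    | nil => exact hp3 ρ hρ
    | append_singleton σ j ih => rw [estep]; exact hp3 _ (ih j)
  have hprop : ∀ σ, ρ <+: e σ ∧ e σ ∈ P ∧ (N ≤ (e σ).length ∨ e σ ∈ F) := by
    intro σ
    induction σ using List.reverseRecOn with
    | nil => exact ⟨(hp2 ρ hρ List.prefix_rfl).1, (hp2 ρ hρ List.prefix_rfl).2, hp4 ρ hρ⟩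
    | append_singleton σ j ih =>
      have h := hp2 _ (hsd σ j) (ih.1.trans (List.prefix_append _ _))
      rw [estep]
      exact ⟨h.1, h.2, hp4 _ (hsd σ j)⟩
  have hstep : ∀ σ i, e σ ++ [i] <+: e (σ ++ [i]) := fun σ i => by
    rw [estep]
    exact hp1 _ (hsd σ i)
  refine ⟨Set.range e, isLeftRightTreeCopy_of_step hstep, fun f hf => ?_, ?_⟩
  · by_contra hne
    -- If `f` were missed, the picks in the direction of `f` would be ever longer prefixes of `f`.
    have hlong : ∀ n, ∃ σ, e σ <+: f ∧ n ≤ (e σ).length := by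
      intro n
      induction n with
      | zero => exact ⟨[], (hp5 ρ hρ f hf (hF f hf).1).2, Nat.zero_le _⟩
      | succ n ih =>
        obtain ⟨σ, h1, h2⟩ := ih
        obtain ⟨i, hi⟩ := exists_append_singleton_prefix h1 fun h => hne ⟨σ, h⟩
        refine ⟨σ ++ [i], ?_, ?_⟩
        · rw [estep]
          exact (hp5 _ (hsd σ i) f hf hi).2
        · have := (hstep σ i).length_le
          simp at this
          omega
    obtain ⟨σ, h1, h2⟩ := hlong (f.length + 1)
    have := h1.length_le
    omega
  · rintro _ ⟨σ, rfl⟩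
    exact hprop σ

/-! ### Codes of vertices -/

theorem encode_node_cons (a : Bool) (σ : Node) :
    Encodable.encode (a :: σ) = Nat.pair (Encodable.encode a) (Encodable.encode σ) + 1 := rfl

/-- Vertices of length at least `n` thus do not affect the first `n` symbols of a characteristic
function. -/
theorem length_le_encode (σ : Node) : σ.length ≤ Encodable.encode σ := by
  induction σ with
  | nil => simp
  | cons a σ ih =>
    rw [encode_node_cons, List.length_cons]
    exact Nat.succ_le_succ (ih.trans (Nat.right_le_pair _ _))

/-- This keeps meets inside an initial segment of a characteristic function: a meet has no larger
code than the vertices it comes from. -/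
theorem encode_le_of_prefix {σ τ : Node} (h : σ <+: τ) :
    Encodable.encode σ ≤ Encodable.encode τ := by
  induction σ generalizing τ with
  | nil => simp
  | cons a σ ih =>
    cases τ with
    | nil => simp at h
    | cons b τ =>
      obtain ⟨rfl, h'⟩ := List.cons_prefix_cons.1 h
      rw [encode_node_cons, encode_node_cons]
      have := ih h'
      rcases this.eq_or_lt with h1 | h1
      · rw [h1]
      · exact Nat.succ_le_succ (Nat.pair_lt_pair_right _ h1).le

/-- The vertices with code less than `n`. -/
def nodesBelow (n : ℕ) : List Node := (List.range n).filterMap (Encodable.decode₂ Node)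

theorem mem_nodesBelow {n : ℕ} {σ : Node} : σ ∈ nodesBelow n ↔ Encodable.encode σ < n := by
  simp only [nodesBelow, List.mem_filterMap, List.mem_range]
  constructor
  · rintro ⟨a, ha, h⟩
    rwa [Encodable.mem_decode₂.1 h]
  · intro h
    exact ⟨_, h, Encodable.mem_decode₂.2 rfl⟩

/-! ### Searching for finite monochromatic trees -/

/-- The vertices in the set with the finite characteristic function `s`. -/
def members (s : List Bool) : List Node :=
  (nodesBelow s.length).filter fun σ => decide (s[Encodable.encode σ]? = some true)

theorem mem_members {s : List Bool} {σ : Node} :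
    σ ∈ members s ↔ s[Encodable.encode σ]? = some true := by
  simp only [members, List.mem_filter, mem_nodesBelow, decide_eq_true_eq, and_iff_right_iff_imp]
  exact fun h => (List.getElem?_eq_some_iff.1 h).1

/-- The roots of the cones into which a finite tree above `ρ` is extended. -/
def ends (ρ : Node) (s : List Bool) : List Node :=
  ρ :: (members s).flatMap fun σ => [σ ++ [false], σ ++ [true]]

theorem append_mem_ends {ρ σ : Node} {s : List Bool} (h : σ ∈ members s) (i : Bool) :
    σ ++ [i] ∈ ends ρ s := by
  simp only [ends, List.mem_cons, List.mem_flatMap]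
  exact Or.inr ⟨σ, h, by cases i <;> simp⟩

theorem prefix_of_mem_ends {ρ ε : Node} {s : List Bool} (h : ∀ σ ∈ members s, ρ <+: σ)
    (hε : ε ∈ ends ρ s) : ρ <+: ε := by
  simp only [ends, List.mem_cons, List.mem_flatMap, List.not_mem_nil, or_false] at hε
  rcases hε with rfl | ⟨σ, hσ, rfl | rfl⟩
  · exact List.prefix_rfl
  · exact (h σ hσ).trans (List.prefix_append _ _)
  · exact (h σ hσ).trans (List.prefix_append _ _)

/-- The position at which the answer for `s` is found. -/
def answerIndex (s : List Bool) : ℕ := 2 * Encodable.encode (s.map Bool.toNat) + 1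

/-- The finite input `U` assigns the colour `b` to `σ`. -/
def HasColour (U : List ℕ) (b : Bool) (σ : Node) : Prop :=
  U[2 * Encodable.encode σ]? = some b.toNat

/-- `s` describes a finite set of vertices closed under meets. -/
def MeetClosed (s : List Bool) : Prop :=
  ∀ σ ∈ members s, ∀ τ ∈ members s, ∀ μ ∈ nodesBelow s.length,
    μ ++ [false] <+: σ → μ ++ [true] <+: τ → μ ∈ members s

/-- According to the finite input `U`, the set `s` is a finite tree of colour `b` above `ρ` and
there is an answer for `s`. -/
def Good (U : List ℕ) (b : Bool) (ρ : Node) (s : List Bool) : Prop :=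
  U.getD (answerIndex s) 0 ≠ 0 ∧ (∀ σ ∈ members s, ρ <+: σ ∧ HasColour U b σ) ∧ MeetClosed s

open Classical in
/-- Tests one candidate, which is determined by the length of the input. -/
noncomputable def tryCandidate (U : List ℕ) (b : Bool) (ρ : Node) : Option (List Bool) :=
  (Encodable.decode (α := List Bool) U.length.unpair.1).bind fun s =>
    if Good U b ρ s then some s else none

/-- The first good candidate of colour `b` above `ρ`. -/
noncomputable def findAbove (U : List ℕ) (b : Bool) (ρ : Node) : Option (List Bool) :=
  firstSome (fun m => tryCandidate (U.take m) b ρ) U.length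

/-- The first good candidate of any colour, with its colour. -/
noncomputable def findFirst (U : List ℕ) : Option (Bool × List Bool) :=
  firstSome (fun m => (tryCandidate (U.take m) true []).map (Prod.mk true) <|>
    (tryCandidate (U.take m) false []).map (Prod.mk false)) U.length

/-- If `τ` is above `ρ`, then some vertex above `τ` has colour `b` according to `U`. -/
def Covered (U : List ℕ) (b : Bool) (ρ τ : Node) : Prop :=
  ρ <+: τ → ∃ υ ∈ nodesBelow U.length, τ <+: υ ∧ HasColour U b υ

/-- Above `ρ`, the set of the vertices of colour `b` looks dense in `U` for at least as long as
that of the vertices of the other colour. -/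
def Prefers (U : List ℕ) (b : Bool) (ρ : Node) : Prop :=
  ∃ τ ∈ nodesBelow U.length, ¬ Covered U (!b) ρ τ ∧
    ∀ τ' ∈ nodesBelow (Encodable.encode τ), Covered U b ρ τ'

/-- There is a finite tree of the colour other than `b` above `ρ` all ends of which prefer that
colour. -/
def PrefersOther (U : List ℕ) (b : Bool) (ρ : Node) : Prop :=
  ∃ s ∈ (findAbove U (!b) ρ).toList, ∀ ε ∈ ends ρ s, ¬ Prefers U b ε

open Classical in
/-- The index of the first end of `s` that prefers the colour other than `b`, or the number of
ends if there is none. -/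
noncomputable def preferredEnd (U : List ℕ) (b : Bool) (s : List Bool) : ℕ :=
  (ends [] s).findIdx fun ε => decide (PrefersOther U b ε)

/-- The even positions of a finite input. -/
def evens (σ : List ℕ) : List ℕ := (List.range (σ.length / 2)).filterMap fun i => σ[2 * i]?

theorem evens_initSeg (p q : ℕ → ℕ) (n : ℕ) : evens (initSeg (join p q) n) = initSeg p (n / 2) := by
  simp only [evens, initSeg_length]
  rw [show initSeg p (n / 2) = (List.range (n / 2)).filterMap (some ∘ p) by
    rw [List.filterMap_eq_map]; rfl]
  refine List.filterMap_congr fun i hi => ?_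
  rw [List.mem_range] at hi
  rw [initSeg_getElem?, if_pos (by omega), join_even]
  rfl

/-! ### The search is computable -/

theorem primrecRel_prefix : PrimrecRel fun σ τ : Node => σ <+: τ := by
  have : PrimrecRel fun σ τ : Node => σ = τ.take σ.length :=
    Primrec.eq.comp Primrec.fst
      (Primrec.list_take.comp (Primrec.list_length.comp Primrec.fst) Primrec.snd)
  exact PrimrecPred.of_eq this fun _ => List.prefix_iff_eq_take.symm

theorem PrimrecPred.imp' {α : Type} [Primcodable α] {p q : α → Prop} (hp : PrimrecPred p)
    (hq : PrimrecPred q) : PrimrecPred fun a => p a → q a := by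
  classical
  exact PrimrecPred.of_eq (hp.not.or hq) fun _ => imp_iff_not_or.symm

theorem primrec_nodesBelow : Primrec nodesBelow := by
  have : Primrec (Encodable.decode₂ Node) := Primrec.decode₂
  exact Primrec.listFilterMap Primrec.list_range (this.comp Primrec.snd)

theorem primrec_members : Primrec members := by
  have hR : PrimrecRel fun (σ : Node) (s : List Bool) => s[Encodable.encode σ]? = some true :=
    Primrec.eq.comp (Primrec.list_getElem?.comp Primrec.snd (Primrec.encode.comp Primrec.fst))
      (Primrec.const _)
  exact hR.listFilter.comp (primrec_nodesBelow.comp Primrec.list_length) Primrec.id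

theorem primrec_snoc (i : Bool) : Primrec fun σ : Node => σ ++ [i] :=
  Primrec.list_append.comp Primrec.id (Primrec.const _)

theorem primrec_ends : Primrec₂ ends := by
  refine Primrec.list_cons.comp Primrec.fst (Primrec.list_flatMap (primrec_members.comp Primrec.snd)
    ?_)
  exact Primrec.list_cons.comp ((primrec_snoc _).comp Primrec.snd)
    (Primrec.list_cons.comp ((primrec_snoc _).comp Primrec.snd) (Primrec.const _))

theorem primrec_toNat : Primrec Bool.toNat := Primrec.dom_finite _

theorem primrec_answerIndex : Primrec answerIndex :=
  Primrec.succ.comp (primrec_double.comp (Primrec.encode.comp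
    (Primrec.list_map Primrec.id (primrec_toNat.comp Primrec.snd))))

theorem primrecPred_hasColour {α : Type} [Primcodable α] {f : α → List ℕ} {g : α → Bool}
    {k : α → Node} (hf : Primrec f) (hg : Primrec g) (hk : Primrec k) :
    PrimrecPred fun a => HasColour (f a) (g a) (k a) :=
  Primrec.eq.comp (Primrec.list_getElem?.comp hf (primrec_double.comp (Primrec.encode.comp hk)))
    (Primrec.option_some.comp (primrec_toNat.comp hg))

theorem primrecPred_forall_mem {α β : Type} [Primcodable α] [Primcodable β] {f : α → List β}
    {R : α → β → Prop} (hf : Primrec f) (hR : PrimrecPred fun x : α × β => R x.1 x.2) :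
    PrimrecPred fun a => ∀ b ∈ f a, R a b := by
  have : PrimrecRel fun (b : β) (a : α) => R a b := hR.comp (Primrec.snd.pair Primrec.fst)
  exact this.forall_mem_list.comp hf Primrec.id

theorem primrecPred_exists_mem {α β : Type} [Primcodable α] [Primcodable β] {f : α → List β}
    {R : α → β → Prop} (hf : Primrec f) (hR : PrimrecPred fun x : α × β => R x.1 x.2) :
    PrimrecPred fun a => ∃ b ∈ f a, R a b := by
  have : PrimrecRel fun (b : β) (a : α) => R a b := hR.comp (Primrec.snd.pair Primrec.fst)
  exact this.exists_mem_list.comp hf Primrec.id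

theorem primrecPred_mem {α : Type} [Primcodable α] {f : α → Node} {g : α → List Node}
    (hf : Primrec f) (hg : Primrec g) : PrimrecPred fun a => f a ∈ g a := by
  refine PrimrecPred.of_eq (primrecPred_exists_mem (R := fun a σ => f a = σ) hg
    (Primrec.eq.comp (hf.comp Primrec.fst) Primrec.snd)) fun a => ?_
  simp

theorem primrecPred_meetClosed : PrimrecPred MeetClosed := by
  refine primrecPred_forall_mem primrec_members ?_
  refine primrecPred_forall_mem (primrec_members.comp Primrec.fst) ?_
  refine primrecPred_forall_mem
    (primrec_nodesBelow.comp (Primrec.list_length.comp (Primrec.fst.comp Primrec.fst))) ?_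
  refine PrimrecPred.imp' (primrecRel_prefix.comp ((primrec_snoc _).comp Primrec.snd)
    (Primrec.snd.comp (Primrec.fst.comp Primrec.fst))) ?_
  refine PrimrecPred.imp' (primrecRel_prefix.comp ((primrec_snoc _).comp Primrec.snd)
    (Primrec.snd.comp Primrec.fst)) ?_
  exact primrecPred_mem Primrec.snd
    (primrec_members.comp (Primrec.fst.comp (Primrec.fst.comp Primrec.fst)))

theorem primrecPred_good {α : Type} [Primcodable α] {f : α → List ℕ} {g : α → Bool}
    {k : α → Node} {l : α → List Bool} (hf : Primrec f) (hg : Primrec g) (hk : Primrec k)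
    (hl : Primrec l) : PrimrecPred fun a => Good (f a) (g a) (k a) (l a) := by
  refine PrimrecPred.and (PrimrecPred.not ?_) (PrimrecPred.and ?_ (primrecPred_meetClosed.comp hl))
  · exact Primrec.eq.comp ((Primrec.list_getD 0).comp hf (primrec_answerIndex.comp hl))
      (Primrec.const 0)
  · refine primrecPred_forall_mem (primrec_members.comp hl) (PrimrecPred.and
      (primrecRel_prefix.comp (hk.comp Primrec.fst) Primrec.snd)
      (primrecPred_hasColour (hf.comp Primrec.fst) (hg.comp Primrec.fst) Primrec.snd))

theorem primrec_tryCandidate {α : Type} [Primcodable α] {f : α → List ℕ} {g : α → Bool}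
    {k : α → Node} (hf : Primrec f) (hg : Primrec g) (hk : Primrec k) :
    Primrec fun a => tryCandidate (f a) (g a) (k a) := by
  classical
  refine Primrec.option_bind (Primrec.decode.comp
    (Primrec.fst.comp (Primrec.unpair.comp (Primrec.list_length.comp hf)))) ?_
  exact Primrec.ite (primrecPred_good (hf.comp Primrec.fst) (hg.comp Primrec.fst)
    (hk.comp Primrec.fst) Primrec.snd) (Primrec.option_some.comp Primrec.snd) (Primrec.const none)

theorem primrec_findAbove {α : Type} [Primcodable α] {f : α → List ℕ} {g : α → Bool}
    {k : α → Node} (hf : Primrec f) (hg : Primrec g) (hk : Primrec k) :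
    Primrec fun a => findAbove (f a) (g a) (k a) :=
  primrec_firstSome (primrec_tryCandidate
    (Primrec.list_take.comp Primrec.snd (hf.comp Primrec.fst)) (hg.comp Primrec.fst)
    (hk.comp Primrec.fst)) (Primrec.list_length.comp hf)

theorem primrec_findFirst : Primrec findFirst := by
  have h (b : Bool) : Primrec₂ fun (U : List ℕ) (m : ℕ) =>
      (tryCandidate (U.take m) b []).map (Prod.mk b) :=
    Primrec.option_map (primrec_tryCandidate (Primrec.list_take.comp Primrec.snd Primrec.fst)
      (Primrec.const b) (Primrec.const [])) ((Primrec.const b).pair Primrec.snd)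
  exact primrec_firstSome (Primrec.option_orElse.comp (h true) (h false)) Primrec.list_length

theorem primrecPred_covered {α : Type} [Primcodable α] {f : α → List ℕ} {g : α → Bool}
    {k l : α → Node} (hf : Primrec f) (hg : Primrec g) (hk : Primrec k) (hl : Primrec l) :
    PrimrecPred fun a => Covered (f a) (g a) (k a) (l a) :=
  PrimrecPred.imp' (primrecRel_prefix.comp hk hl)
    (primrecPred_exists_mem (primrec_nodesBelow.comp (Primrec.list_length.comp hf))
      (PrimrecPred.and (primrecRel_prefix.comp (hl.comp Primrec.fst) Primrec.snd)
        (primrecPred_hasColour (hf.comp Primrec.fst) (hg.comp Primrec.fst) Primrec.snd)))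

theorem primrecPred_prefers {α : Type} [Primcodable α] {f : α → List ℕ} {g : α → Bool}
    {k : α → Node} (hf : Primrec f) (hg : Primrec g) (hk : Primrec k) :
    PrimrecPred fun a => Prefers (f a) (g a) (k a) := by
  refine primrecPred_exists_mem (primrec_nodesBelow.comp (Primrec.list_length.comp hf))
    (PrimrecPred.and (PrimrecPred.not (primrecPred_covered (hf.comp Primrec.fst)
      (Primrec.not.comp (hg.comp Primrec.fst)) (hk.comp Primrec.fst) Primrec.snd)) ?_)
  exact primrecPred_forall_mem (primrec_nodesBelow.comp (Primrec.encode.comp Primrec.snd))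
    (primrecPred_covered (hf.comp (Primrec.fst.comp Primrec.fst))
      (hg.comp (Primrec.fst.comp Primrec.fst)) (hk.comp (Primrec.fst.comp Primrec.fst)) Primrec.snd)

theorem primrecPred_prefersOther {α : Type} [Primcodable α] {f : α → List ℕ} {g : α → Bool}
    {k : α → Node} (hf : Primrec f) (hg : Primrec g) (hk : Primrec k) :
    PrimrecPred fun a => PrefersOther (f a) (g a) (k a) := by
  refine primrecPred_exists_mem (Primrec.optionToList.comp
    (primrec_findAbove hf (Primrec.not.comp hg) hk)) ?_
  refine primrecPred_forall_mem (primrec_ends.comp (hk.comp Primrec.fst) Primrec.snd) ?_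
  exact PrimrecPred.not (primrecPred_prefers (hf.comp (Primrec.fst.comp Primrec.fst))
    (hg.comp (Primrec.fst.comp Primrec.fst)) Primrec.snd)

theorem primrec_preferredEnd {α : Type} [Primcodable α] {f : α → List ℕ} {g : α → Bool}
    {k : α → List Bool} (hf : Primrec f) (hg : Primrec g) (hk : Primrec k) :
    Primrec fun a => preferredEnd (f a) (g a) (k a) := by
  classical
  exact Primrec.list_findIdx (primrec_ends.comp (Primrec.const []) hk)
    (primrecPred_prefersOther (hf.comp Primrec.fst) (hg.comp Primrec.fst) Primrec.snd).decide

theorem primrec_evens : Primrec evens :=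
  Primrec.listFilterMap (Primrec.list_range.comp (primrec_div_two.comp Primrec.list_length))
    (Primrec.list_getElem?.comp Primrec.fst (primrec_double.comp Primrec.snd))

/-! ### The search is correct -/

section

variable {u : ℕ → ℕ} {b : Bool} {ρ : Node} {s : List Bool}

/-- The infinite version of `Good`. -/
def GoodAt (u : ℕ → ℕ) (b : Bool) (ρ : Node) (s : List Bool) : Prop :=
  u (answerIndex s) ≠ 0 ∧
    (∀ σ ∈ members s, ρ <+: σ ∧ u (2 * Encodable.encode σ) = b.toNat) ∧ MeetClosed s

theorem getD_initSeg (u : ℕ → ℕ) (m n : ℕ) :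
    (initSeg u m).getD n 0 = if n < m then u n else 0 := by
  rw [List.getD_eq_getElem?_getD, initSeg_getElem?]
  split_ifs <;> rfl

/-- Being good depends on the input only through finitely many positions, so it persists at later
stages. -/
theorem good_initSeg {m : ℕ} : Good (initSeg u m) b ρ s ↔
    GoodAt u b ρ s ∧ answerIndex s < m ∧ ∀ σ ∈ members s, 2 * Encodable.encode σ < m := by
  simp only [Good, GoodAt, HasColour, getD_initSeg, initSeg_getElem?_eq_some]
  constructor
  · rintro ⟨h1, h2, h3⟩
    have hm : answerIndex s < m := by
      by_contra hm
      simp [hm] at h1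
    rw [if_pos hm] at h1
    exact ⟨⟨h1, fun σ hσ => ⟨(h2 σ hσ).1, (h2 σ hσ).2.2⟩, h3⟩, hm, fun σ hσ => (h2 σ hσ).2.1⟩
  · rintro ⟨⟨h1, h2, h3⟩, hm, h4⟩
    rw [if_pos hm]
    exact ⟨h1, fun σ hσ => ⟨(h2 σ hσ).1, h4 σ hσ, (h2 σ hσ).2⟩, h3⟩

theorem good_of_tryCandidate {U : List ℕ} (h : tryCandidate U b ρ = some s) : Good U b ρ s := by
  simp only [tryCandidate, Option.bind_eq_some_iff] at h
  obtain ⟨t, -, h⟩ := h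
  split_ifs at h with hg
  · cases h
    exact hg

theorem exists_tryCandidate (h : GoodAt u b ρ s) :
    ∃ m, tryCandidate (initSeg u m) b ρ = some s := by
  obtain ⟨N, h1, h2⟩ : ∃ N, answerIndex s < N ∧ ∀ σ ∈ members s, 2 * Encodable.encode σ < N := by
    refine ⟨answerIndex s + 2 * s.length + 1, by omega, fun σ hσ => ?_⟩
    have := (List.getElem?_eq_some_iff.1 (mem_members.1 hσ)).1
    omega
  have hN : N ≤ Nat.pair (Encodable.encode s) N := Nat.right_le_pair _ _
  -- Each candidate is tested at infinitely many lengths; this one is at least `N`, which makes all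
  -- relevant positions available.
  refine ⟨Nat.pair (Encodable.encode s) N, ?_⟩
  have hg : Good (initSeg u (Nat.pair (Encodable.encode s) N)) b ρ s :=
    good_initSeg.2 ⟨h, by omega, fun σ hσ => (h2 σ hσ).trans_le hN⟩
  simp [tryCandidate, initSeg_length, hg]

theorem findAbove_initSeg (u : ℕ → ℕ) (b : Bool) (ρ : Node) (m : ℕ) :
    findAbove (initSeg u m) b ρ = firstSome (fun k => tryCandidate (initSeg u k) b ρ) m := by
  rw [findAbove, initSeg_length]
  exact firstSome_congr fun k hk => by rw [initSeg_take u hk]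

theorem findAbove_mono {m n : ℕ} (h : m ≤ n) (hs : findAbove (initSeg u m) b ρ = some s) :
    findAbove (initSeg u n) b ρ = some s := by
  rw [findAbove_initSeg] at hs ⊢
  exact firstSome_mono h hs

theorem good_of_findAbove {m : ℕ} (hs : findAbove (initSeg u m) b ρ = some s) :
    Good (initSeg u m) b ρ s := by
  rw [findAbove_initSeg] at hs
  obtain ⟨k, hk, h, -⟩ := exists_of_firstSome hs
  obtain ⟨h1, h2, h3⟩ := good_initSeg.1 (good_of_tryCandidate h)
  exact good_initSeg.2 ⟨h1, h2.trans_le hk, fun σ hσ => (h3 σ hσ).trans_le hk⟩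

theorem exists_findAbove (h : GoodAt u b ρ s) :
    ∃ m s', findAbove (initSeg u m) b ρ = some s' := by
  obtain ⟨m, hm⟩ := exists_tryCandidate h
  obtain ⟨s', hs'⟩ := firstSome_isSome (u := fun k => tryCandidate (initSeg u k) b ρ)
    (le_refl m) hm
  exact ⟨m, s', by rw [findAbove_initSeg, hs']⟩

theorem findFirst_initSeg (u : ℕ → ℕ) (m : ℕ) : findFirst (initSeg u m) =
    firstSome (fun k => (tryCandidate (initSeg u k) true []).map (Prod.mk true) <|>
      (tryCandidate (initSeg u k) false []).map (Prod.mk false)) m := by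
  rw [findFirst, initSeg_length]
  exact firstSome_congr fun k hk => by rw [initSeg_take u hk]

theorem findFirst_mono {m n : ℕ} (h : m ≤ n) {d : Bool × List Bool}
    (hs : findFirst (initSeg u m) = some d) : findFirst (initSeg u n) = some d := by
  rw [findFirst_initSeg] at hs ⊢
  exact firstSome_mono h hs

theorem good_of_findFirst {m : ℕ} (hs : findFirst (initSeg u m) = some (b, s)) :
    Good (initSeg u m) b [] s := by
  rw [findFirst_initSeg] at hs
  obtain ⟨k, hk, h, -⟩ := exists_of_firstSome hs
  have h : tryCandidate (initSeg u k) b [] = some s := by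
    cases h1 : tryCandidate (initSeg u k) true [] <;>
      cases h2 : tryCandidate (initSeg u k) false [] <;> simp_all
  obtain ⟨h1, h2, h3⟩ := good_initSeg.1 (good_of_tryCandidate h)
  exact good_initSeg.2 ⟨h1, h2.trans_le hk, fun σ hσ => (h3 σ hσ).trans_le hk⟩

theorem exists_findFirst (h : GoodAt u b [] s) : ∃ m d, findFirst (initSeg u m) = some d := by
  obtain ⟨m, hm⟩ := exists_tryCandidate h
  obtain ⟨a, ha⟩ : ∃ a, ((tryCandidate (initSeg u m) true []).map (Prod.mk true) <|>
      (tryCandidate (initSeg u m) false []).map (Prod.mk false)) = some a := by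
    cases b <;> cases h1 : tryCandidate (initSeg u m) true [] <;> simp_all
  obtain ⟨d, hd⟩ := firstSome_isSome (u := fun k =>
    (tryCandidate (initSeg u k) true []).map (Prod.mk true) <|>
      (tryCandidate (initSeg u k) false []).map (Prod.mk false)) (le_refl m) ha
  exact ⟨m, d, by rw [findFirst_initSeg, hd]⟩

/-- The vertices of colour `b`. -/
def colourClass (u : ℕ → ℕ) (b : Bool) : Set Node := {σ | u (2 * Encodable.encode σ) = b.toNat}

theorem covered_initSeg {m : ℕ} {τ : Node} : Covered (initSeg u m) b ρ τ ↔
    (ρ <+: τ → ∃ υ, τ <+: υ ∧ υ ∈ colourClass u b ∧ 2 * Encodable.encode υ < m) := by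
  simp only [Covered, HasColour, mem_nodesBelow, initSeg_length, initSeg_getElem?_eq_some,
    colourClass, Set.mem_ofPred_eq]
  refine imp_congr_right fun _ => exists_congr fun υ => ⟨?_, ?_⟩
  · rintro ⟨-, h1, h2, h3⟩
    exact ⟨h1, h3, h2⟩
  · rintro ⟨h1, h2, h3⟩
    exact ⟨by omega, h1, h3, h2⟩

/-- Each `τ` is covered for good once one witness has been read, and only finitely many `τ` are
concerned. -/
theorem eventually_covered (hd : ∀ τ, ρ <+: τ → ∃ υ, τ <+: υ ∧ υ ∈ colourClass u b) (N : ℕ) :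
    ∃ M, ∀ m ≥ M, ∀ τ ∈ nodesBelow N, Covered (initSeg u m) b ρ τ := by
  have h1 : ∀ τ, ∃ M, ∀ m ≥ M, Covered (initSeg u m) b ρ τ := by
    intro τ
    by_cases hτ : ρ <+: τ
    · obtain ⟨υ, h1, h2⟩ := hd τ hτ
      exact ⟨2 * Encodable.encode υ + 1, fun m hm => covered_initSeg.2 fun _ =>
        ⟨υ, h1, h2, by omega⟩⟩
    · exact ⟨0, fun m _ h => absurd h hτ⟩
  choose f hf using h1
  generalize nodesBelow N = l
  induction l with
  | nil => exact ⟨0, by simp⟩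
  | cons τ l ih =>
    obtain ⟨M, hM⟩ := ih
    refine ⟨max M (f τ), fun m hm υ hυ => ?_⟩
    rcases List.mem_cons.1 hυ with rfl | hυ
    · exact hf _ m ((le_max_right _ _).trans hm)
    · exact hM m ((le_max_left _ _).trans hm) υ hυ

theorem somewhereDense_or_dense (hu : ∀ b, (colourClass u b)ᶜ = colourClass u (!b)) (b : Bool)
    (ρ : Node) : SomewhereDense (colourClass u b) ρ ∨
      ∀ τ, ρ <+: τ → ∃ υ, τ <+: υ ∧ υ ∈ colourClass u (!b) := by
  refine (somewhereDense_or_compl _ ρ).imp_right fun h τ hτ => ?_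
  obtain ⟨υ, h1, h2⟩ := h τ hτ
  exact ⟨υ, h1, hu b ▸ h2 υ List.prefix_rfl⟩

/-- If the other colour is dense above `ρ`, its first uncovered vertex moves beyond every bound.
Preferring `b` at such stages forces `b` to cover everything up to that bound, so `b` is dense as
well. -/
theorem somewhereDense_of_prefers (hu : ∀ b, (colourClass u b)ᶜ = colourClass u (!b))
    (h : ∃ᶠ m in Filter.atTop, Prefers (initSeg u m) b ρ) :
    SomewhereDense (colourClass u b) ρ := by
  rcases somewhereDense_or_dense hu b ρ with hd | hd
  · exact hd
  refine ⟨ρ, List.prefix_rfl, fun τ hτ => ?_⟩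
  obtain ⟨M, hM⟩ := eventually_covered hd (Encodable.encode τ + 1)
  obtain ⟨m, hm, υ, -, h1, h2⟩ := Filter.frequently_atTop.1 h M
  have hlt : Encodable.encode τ < Encodable.encode υ := by
    by_contra! hle
    exact h1 (hM m hm υ (mem_nodesBelow.2 (Nat.lt_succ_of_le hle)))
  obtain ⟨υ', h3, h4, -⟩ := covered_initSeg.1 (h2 τ (mem_nodesBelow.2 hlt)) hτ
  exact ⟨υ', h3, h4⟩

theorem somewhereDense_of_not_prefers (hu : ∀ b, (colourClass u b)ᶜ = colourClass u (!b))
    (h : ∃ᶠ m in Filter.atTop, ¬ Prefers (initSeg u m) b ρ) :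
    SomewhereDense (colourClass u (!b)) ρ := by
  rcases somewhereDense_or_dense hu (!b) ρ with hd | hd
  · exact hd
  rw [Bool.not_not] at hd
  refine ⟨ρ, List.prefix_rfl, fun τ hτ => ?_⟩
  obtain ⟨M, hM⟩ := eventually_covered hd (Encodable.encode τ)
  -- The stage must also exceed the code of `τ`, so that an uncovered `τ` would be an admissible
  -- witness for `Prefers`.
  obtain ⟨m, hm, h1⟩ := Filter.frequently_atTop.1 h (max M (Encodable.encode τ + 1))
  have hc : Covered (initSeg u m) (!b) ρ τ := by
    by_contra hc
    exact h1 ⟨τ, mem_nodesBelow.2 (by rw [initSeg_length]; omega), hc, fun τ' hτ' =>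
      hM m ((le_max_left _ _).trans hm) τ' hτ'⟩
  obtain ⟨υ', h3, h4, -⟩ := covered_initSeg.1 hc hτ
  exact ⟨υ', h3, h4⟩

end

/-! ### Finite guessability -/

/-- The list `p(0), s(0), …, p(n-1), s(n-1)`, where `n` is the length of the second argument and
missing values are replaced by `0`. -/
def joinList (p s : List ℕ) : List ℕ :=
  (List.range (2 * s.length)).map fun i =>
    bif decide (i % 2 = 0) then p.getD (i / 2) 0 else s.getD (i / 2) 0

theorem joinList_initSeg (p s : ℕ → ℕ) {m n : ℕ} (h : n ≤ m) :
    joinList (initSeg p m) (initSeg s n) = initSeg (join p s) (2 * n) := by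
  simp only [joinList, initSeg_length]
  rw [show initSeg (join p s) (2 * n) = (List.range (2 * n)).map (join p s) from rfl]
  refine List.map_congr_left fun i hi => ?_
  rw [List.mem_range] at hi
  rw [getD_initSeg, getD_initSeg, if_pos (by omega), if_pos (by omega), Bool.cond_decide]
  rfl

theorem primrec_joinList : Primrec₂ joinList := by
  refine Primrec.list_map (Primrec.list_range.comp (primrec_double.comp
    (Primrec.list_length.comp Primrec.snd))) ?_
  refine Primrec.cond (PrimrecPred.decide (p := fun x : (List ℕ × List ℕ) × ℕ => x.2 % 2 = 0)
    (Primrec.eq.comp (primrec_mod_two.comp Primrec.snd) (Primrec.const 0))) ?_ ?_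
  · exact (Primrec.list_getD 0).comp (Primrec.fst.comp Primrec.fst)
      (primrec_div_two.comp Primrec.snd)
  · exact (Primrec.list_getD 0).comp (Primrec.snd.comp Primrec.fst)
      (primrec_div_two.comp Primrec.snd)

/-- The number of symbols that are output before step `j`, if at most one symbol of the growing
list `L` is output in each step. -/
def emitted (L : ℕ → List ℕ) : ℕ → ℕ
  | 0 => 0
  | j + 1 => bif ((L j)[emitted L j]?).isSome then emitted L j + 1 else emitted L j

/-- The delayed output of the growing list `L`. -/
def delay (L : ℕ → List ℕ) (j : ℕ) : ℕ := (((L j)[emitted L j]?).map Nat.succ).getD 0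

theorem delay_ne_zero {L : ℕ → List ℕ} {j : ℕ} :
    delay L j ≠ 0 ↔ ((L j)[emitted L j]?).isSome := by
  unfold delay
  cases (L j)[emitted L j]? <;> simp

theorem emitted_eq_count (L : ℕ → List ℕ) (j : ℕ) :
    emitted L j = Nat.count (fun i => delay L i ≠ 0) j := by
  induction j with
  | zero => simp [emitted]
  | succ j ih =>
    rw [Nat.count_succ, ← ih, emitted]
    by_cases h : delay L j ≠ 0
    · rw [if_pos h, delay_ne_zero.1 h]
      rfl
    · have h' := h
      rw [delay_ne_zero, Bool.not_eq_true] at h'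
      rw [if_neg h, h']
      rfl

/-- `emitted` counts the nonzero symbols so far, so the `n`-th nonzero symbol is the successor of
entry `n` of the list. The output never stalls, because the next awaited entry is eventually present
at all later steps. -/
theorem delayedName_delay {Y : Type} [RepresentedSpace Y] {L : ℕ → List ℕ} {q : ℕ → ℕ} {y : Y}
    (hy : Names q y) (h1 : ∀ j n a, (L j)[n]? = some a → q n = a)
    (h2 : ∀ n : ℕ, ∃ j : ℕ, ∀ k ≥ j, ((L k)[n]?).isSome = true) : DelayedName (delay L) y := by
  have hinf : {i | delay L i ≠ 0}.Infinite := by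
    refine Set.infinite_of_forall_exists_gt fun J => ?_
    by_contra! hJ
    have hE : ∀ j, emitted L (J + 1 + j) = emitted L (J + 1) := by
      intro j
      induction j with
      | zero => rfl
      | succ j ih =>
        rw [← ih, emitted_eq_count, emitted_eq_count, ← add_assoc, Nat.count_succ, if_neg,
          add_zero]
        exact fun h => absurd (hJ _ h) (by omega)
    obtain ⟨j, hj⟩ := h2 (emitted L (J + 1))
    refine absurd (hJ (J + 1 + j) ?_) (by omega)
    change delay L (J + 1 + j) ≠ 0
    rw [delay_ne_zero, hE]
    exact hj _ (by omega)
  refine ⟨hinf, ?_⟩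
  convert hy using 1
  funext n
  have h3 : delay L (Nat.nth (fun i => delay L i ≠ 0) n) ≠ 0 := Nat.nth_mem_of_infinite hinf n
  have h4 : emitted L (Nat.nth (fun i => delay L i ≠ 0) n) = n := by
    rw [emitted_eq_count]
    exact Nat.count_nth_of_infinite hinf n
  obtain ⟨a, ha⟩ := Option.isSome_iff_exists.1 (delay_ne_zero.1 h3)
  rw [h4] at ha
  rw [undelay, delay, h4, ha, h1 _ _ _ ha]
  rfl

theorem computable_emitted {β : Type} [Primcodable β] {L : β → ℕ → List ℕ} {f : β → ℕ}
    (hL : Computable₂ L) (hf : Computable f) : Computable fun b => emitted (L b) (f b) := by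
  have : Computable fun b => (Nat.rec 0
      (fun j (e : ℕ) => bif ((L b j)[e]?).isSome then e + 1 else e) (f b) : ℕ) := by
    refine Computable.nat_rec (h := fun b (x : ℕ × ℕ) =>
      bif ((L b x.1)[x.2]?).isSome then x.2 + 1 else x.2) hf (Computable.const 0) ?_
    have h2 : Computable fun x : β × ℕ × ℕ => x.2.2 := Computable.snd.comp Computable.snd
    exact Computable.cond (Primrec.option_isSome.to_comp.comp (Computable.list_getElem?.comp
      (hL.comp Computable.fst (Computable.fst.comp Computable.snd)) h2))
      (Computable.succ.comp h2) h2
  refine this.of_eq fun b => ?_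
  induction f b with
  | zero => rfl
  | succ n ih => simp only [emitted, ← ih]

theorem computable_delay {β : Type} [Primcodable β] {L : β → ℕ → List ℕ} {f : β → ℕ}
    (hL : Computable₂ L) (hf : Computable f) : Computable fun b => delay (L b) (f b) :=
  Computable.option_getD (Computable.option_map (Computable.list_getElem?.comp
    (hL.comp Computable.id hf) (computable_emitted hL hf)) (Computable.succ.comp Computable.snd))
    (Computable.const 0)

theorem emitted_congr {L L' : ℕ → List ℕ} {j : ℕ} (h : ∀ i < j, L i = L' i) :
    emitted L j = emitted L' j := by
  induction j with
  | zero => rfl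
  | succ j ih =>
    simp only [emitted]
    rw [ih fun i hi => h i (by omega), h j (Nat.lt_succ_self j)]

theorem delay_congr {L L' : ℕ → List ℕ} {j : ℕ} (h : ∀ i ≤ j, L i = L' i) :
    delay L j = delay L' j := by
  rw [delay, delay, h j le_rfl, emitted_congr fun i hi => h i hi.le]

theorem initSeg_const (i n : ℕ) : initSeg (fun _ => i) n = List.replicate n i := by
  simp [initSeg]

theorem primrec_replicate : Primrec₂ fun (n i : ℕ) => List.replicate n i :=
  (Primrec.list_map (Primrec.list_range.comp Primrec.fst)
    (Primrec.snd.comp Primrec.fst : Primrec fun x : (ℕ × ℕ) × ℕ => x.1.2).to₂).of_eq fun x => by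
      simp

/-- The representation of the completion is total, so the run on a wrong guess is still a legitimate
entry of the tuple. -/
theorem exists_completion {Y : Type} [RepresentedSpace Y] (p : ℕ → ℕ) :
    ∃ o : Completion Y, Names p o := by
  by_cases h : ∃ y : Y, DelayedName p y
  · obtain ⟨y, hy⟩ := h
    exact ⟨some y, hy⟩
  · push Not at h
    exact ⟨none, h⟩

/-- The `t`-th symbol, for `t = ⟨i, j⟩`, of the delayed outputs of `k` on the joins of the input
with the constant sequences `i`. -/
def guessSymbol (k : List ℕ → List ℕ) (σ : List ℕ) (t : ℕ) : ℕ :=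
  delay (fun j => k (joinList (σ.take j) (List.replicate j t.unpair.1))) t.unpair.2

theorem computable_guessSymbol {k : List ℕ → List ℕ} (kw : WordFunction k) :
    Computable₂ (guessSymbol k) := by
  have hL : Computable₂ fun (x : List ℕ × ℕ) (j : ℕ) =>
      k (joinList (x.1.take j) (List.replicate j x.2.unpair.1)) :=
    kw.1.comp (primrec_joinList.to_comp.comp
      (Primrec.list_take.to_comp.comp Computable.snd (Computable.fst.comp Computable.fst))
      (primrec_replicate.to_comp.comp Computable.snd
        (Computable.fst.comp (Computable.unpair.comp (Computable.snd.comp Computable.fst)))))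
  exact computable_delay (f := fun x : List ℕ × ℕ => x.2.unpair.2) hL
    (Computable.snd.comp (Computable.unpair.comp Computable.snd))

/-- The inner witness announces the number of colours, which is the length of the tuple. Entry `i`
is the delayed run of the outer witness on answer `i`; it is a solution if colour `i` recurs
infinitely often. -/
theorem finitelyGuessable_of_reducible {X Y : Type} [RepresentedSpace X] [RepresentedSpace Y]
    {f : Problem X Y} (hf : f ≤W RT1Plus) : FinitelyGuessable f := by
  obtain ⟨h, k, hw, kw, hhk⟩ := reducible_iff.1 hf
  have hD : Computable fun x : (List ℕ × ℕ) × ℕ =>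
      -- Symbol `j` of a delayed run uses only the first `j` input symbols, so waiting for these
      -- makes the answer final.
      bif decide (x.2.unpair.2 ≤ x.1.1.length) then some (guessSymbol k x.1.1 x.2) else none := by
    refine Computable.cond ?_ (Computable.option_some.comp ((computable_guessSymbol kw).comp
      (Computable.fst.comp Computable.fst) Computable.snd)) (Computable.const none)
    have : PrimrecPred fun x : (List ℕ × ℕ) × ℕ => x.2.unpair.2 ≤ x.1.1.length :=
      Primrec.nat_le.comp (Primrec.snd.comp (Primrec.unpair.comp Primrec.snd))
        (Primrec.list_length.comp (Primrec.fst.comp Primrec.fst))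
    exact this.decide.to_comp
  have hu : Computable₂ fun (σ : List ℕ) (n : ℕ) => (Nat.casesOn n (h σ)[0]? fun t =>
      bif decide (t.unpair.2 ≤ σ.length) then some (guessSymbol k σ t) else none : Option ℕ) :=
    Computable.nat_casesOn (f := fun x : List ℕ × ℕ => x.2)
      (g := fun x : List ℕ × ℕ => (h x.1)[0]?) Computable.snd
      (Computable.list_getElem?.comp (hw.1.comp Computable.fst) (Computable.const 0)) hD.to₂
  obtain ⟨w, ww, hww⟩ := exists_wordFunction_of_sound hu
  refine computableProblem_of_wordFunction ww fun p x hp hx => ?_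
  have hfx : (f x).Nonempty := by
    obtain ⟨l, y, hy, -⟩ := hx
    exact ⟨y, hy⟩
  obtain ⟨r, hr, ⟨K, c⟩, hz, ⟨i, hi⟩, hs⟩ := hhk p x hp hfx
  set L : ℕ → ℕ → List ℕ := fun i j => k (initSeg (join p fun _ => i) (2 * j)) with hLdef
  have hLeq : ∀ i j m, j ≤ m →
      k (joinList ((initSeg p m).take j) (List.replicate j i)) = L i j := by
    intro i j m hjm
    rw [initSeg_take p hjm, ← initSeg_const, joinList_initSeg _ _ le_rfl]
  choose o ho using fun i => exists_completion (Y := Y) (delay (L i))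
  refine ⟨fun n => Nat.casesOn n (r 0) fun t => delay (L t.unpair.1) t.unpair.2,
    hww p _ (fun n => ?_) (fun n m a ha => ?_), (List.range K).map o, ?_, ?_, ?_⟩
  · cases n with
    | zero =>
      obtain ⟨m, hm⟩ := hr.exists_getElem? 0
      exact ⟨m, by simp [hm]⟩
    | succ t =>
      exact ⟨t.unpair.2, by simp [initSeg_length]⟩
  · cases n with
    | zero => exact (hr.getElem? hw ha).symm
    | succ t =>
      by_cases hle : t.unpair.2 ≤ m
      · simp only [initSeg_length, hle, decide_true, cond_true, Option.some.injEq] at ha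
        rw [← ha]
        exact delay_congr fun j hj => hLeq _ _ _ (hj.trans hle)
      · simp [initSeg_length, hle] at ha
  · have hiK : i < K := by
      obtain ⟨n, hn⟩ := hi.nonempty
      exact hn ▸ (c n).2
    obtain ⟨q, hq, y, hy, hqy⟩ := hs (fun _ => i) i hi rfl
    refine ⟨y, hy, ?_⟩
    have hdel : DelayedName (delay (L i)) y := by
      refine delayedName_delay hqy (fun j n a ha => hq.getElem? kw ha) fun n => ?_
      obtain ⟨m, hm⟩ := hq.exists_getElem? n
      refine ⟨m, fun j hj => ?_⟩
      rw [prefix_getElem?_eq_some (kw.2 _ _ (initSeg_prefix _ (by omega))) hm]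
      rfl
    have : o i = some y := names_unique (delay (L i)) _ _ (ho i) hdel
    rw [← this]
    exact List.mem_map.2 ⟨i, List.mem_range.2 hiK, rfl⟩
  · change r 0 = _
    rw [List.length_map, List.length_range]
    exact hz.1
  · intro i hi
    simp only [Nat.unpair_pair, List.getElem_map, List.getElem_range]
    exact ho i

/-! ### The first-order part -/

/-- Baire space, as a represented space. -/
def BaireSpace : Type := ℕ → ℕ

instance : RepresentedSpace BaireSpace where
  Names p u := p = u
  names_unique := fun _ _ _ h h' => h.symm.trans h'
  exists_name := fun u => ⟨u, rfl⟩

/-- An instance consists of a name of an instance `z` of `T` and of an associate of a continuous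
function that is defined on all names of solutions of `z`; its solutions are the values of that
function. -/
def firstOrderPart {Z V : Type} [RepresentedSpace Z] [RepresentedSpace V] (T : Problem Z V) :
    Problem BaireSpace ℕ :=
  fun (u : ℕ → ℕ) => {n | ∃ z, Names (fun i => u (2 * i)) z ∧ (T z).Nonempty ∧
    (∀ v ∈ T z, ∀ s, Names s v → ∃ m, u (2 * Encodable.encode (initSeg s m) + 1) ≠ 0) ∧
    ∃ v ∈ T z, ∃ s m, Names s v ∧ u (2 * Encodable.encode (initSeg s m) + 1) = n + 1}

/-- The odd positions of a finite input. -/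
def odds (σ : List ℕ) : List ℕ := (List.range (σ.length / 2)).filterMap fun i => σ[2 * i + 1]?

theorem odds_initSeg (p q : ℕ → ℕ) (n : ℕ) : odds (initSeg (join p q) n) = initSeg q (n / 2) := by
  simp only [odds, initSeg_length]
  rw [show initSeg q (n / 2) = (List.range (n / 2)).filterMap (some ∘ q) by
    rw [List.filterMap_eq_map]; rfl]
  refine List.filterMap_congr fun i hi => ?_
  rw [List.mem_range] at hi
  rw [initSeg_getElem?, if_pos (by omega), join_odd]
  rfl

theorem primrec_odds : Primrec odds :=
  Primrec.listFilterMap (Primrec.list_range.comp (primrec_div_two.comp Primrec.list_length))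
    (Primrec.list_getElem?.comp Primrec.fst (Primrec.succ.comp (primrec_double.comp Primrec.snd)))

section

variable {Z V : Type} [RepresentedSpace Z] [RepresentedSpace V]

/-- Solve the instance `z` and look up ever more initial segments of the solution's name until the
table has a nonzero entry. -/
theorem firstOrderPart_reducible (T : Problem Z V) : firstOrderPart T ≤W T := by
  have hu : Computable₂ fun (σ : List ℕ) (_ : ℕ) => (Nat.casesOn ((evens σ).getD
      (2 * Encodable.encode ((odds σ).take σ.length.unpair.1) + 1) 0) none some : Option ℕ) := by
    refine Primrec.to_comp (Primrec.nat_casesOn ?_ (Primrec.const none)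
      (Primrec.option_some.comp Primrec.snd))
    refine (Primrec.list_getD 0).comp (primrec_evens.comp Primrec.fst) ?_
    exact Primrec.succ.comp (primrec_double.comp (Primrec.encode.comp (Primrec.list_take.comp
      (Primrec.fst.comp (Primrec.unpair.comp (Primrec.list_length.comp Primrec.fst)))
      (primrec_odds.comp Primrec.fst))))
  -- Different initial segments may carry different entries, all correct; all output symbols must
  -- use the first one found.
  obtain ⟨k, kw, hk⟩ := exists_wordFunction hu
  obtain ⟨h, hw, hh⟩ := exists_wordFunction_select primrec_double
  refine reducible_iff.2 ⟨h, k, hw, kw, ?_⟩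
  rintro p u rfl ⟨n, z, hz, hne, hd, -⟩
  refine ⟨_, hh p, z, hz, hne, fun s v hv hs => ?_⟩
  have hval : ∀ M, (evens (initSeg (join p s) M)).getD (2 * Encodable.encode
      ((odds (initSeg (join p s) M)).take (initSeg (join p s) M).length.unpair.1) + 1) 0 =
      if 2 * Encodable.encode (initSeg s (min M.unpair.1 (M / 2))) + 1 < M / 2 then
        p (2 * Encodable.encode (initSeg s (min M.unpair.1 (M / 2))) + 1) else 0 := by
    intro M
    rw [evens_initSeg, odds_initSeg, initSeg_length, getD_initSeg]
    rcases le_total M.unpair.1 (M / 2) with hM | hM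
    · rw [initSeg_take s hM, min_eq_left hM]
    · rw [List.take_of_length_le (by rwa [initSeg_length]), min_eq_right hM]
  have hex : ∃ M a, (evens (initSeg (join p s) M)).getD (2 * Encodable.encode
      ((odds (initSeg (join p s) M)).take (initSeg (join p s) M).length.unpair.1) + 1) 0 =
      a + 1 := by
    obtain ⟨m, hm⟩ := hd v hv s hs
    -- Half of `N` symbols of the join suffice to contain both the table position and the first `m`
    -- symbols of `s`.
    obtain ⟨N, hN⟩ : ∃ N, N = 2 * (2 * Encodable.encode (initSeg s m) + 2 + m) := ⟨_, rfl⟩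
    have hNM : N ≤ Nat.pair m N := Nat.right_le_pair _ _
    refine ⟨Nat.pair m N, p (2 * Encodable.encode (initSeg s m) + 1) - 1, ?_⟩
    rw [hval, show (Nat.pair m N).unpair.1 = m by simp, min_eq_left (by omega), if_pos (by omega)]
    omega
  classical
  obtain ⟨a, ha⟩ := Nat.find_spec hex
  refine ⟨fun _ => a, hk _ _ fun _ => ⟨Nat.find hex, ?_, fun j hj => ?_⟩, a, ?_, rfl⟩
  · rw [ha]
  · have := Nat.find_min hex hj
    push Not at this
    rcases Nat.eq_zero_or_eq_succ_pred ((evens (initSeg (join p s) j)).getD (2 * Encodable.encode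
      ((odds (initSeg (join p s) j)).take (initSeg (join p s) j).length.unpair.1) + 1) 0) with h | h
    · rw [h]
      rfl
    · exact absurd h (this _)
  · rw [hval] at ha
    split_ifs at ha with hlt
    exact ⟨z, hz, hne, hd, v, hv, s, _, hs, ha⟩

/-- The table records the first output symbol of the outer witness on `p` joined with each finite
word; for codomain `ℕ` this symbol is the whole answer. -/
theorem reducible_firstOrderPart {U : Type} [RepresentedSpace U] {T : Problem Z V}
    {f : Problem U ℕ} (hf : f ≤W T) : f ≤W firstOrderPart T := by
  obtain ⟨h, k, hw, kw, hhk⟩ := reducible_iff.1 hf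
  have hu : Computable₂ fun (τ : List ℕ) (i : ℕ) =>
      bif decide ((Denumerable.ofNat (List ℕ) i).length ≤ τ.length) then
        some (((k (joinList τ (Denumerable.ofNat (List ℕ) i)))[0]?.map Nat.succ).getD 0)
      else none := by
    have hof : Primrec fun x : List ℕ × ℕ => Denumerable.ofNat (List ℕ) x.2 :=
      (Primrec.ofNat (List ℕ)).comp Primrec.snd
    refine Computable.cond ?_ (Computable.option_some.comp ?_) (Computable.const none)
    · have : PrimrecPred fun x : List ℕ × ℕ =>
          (Denumerable.ofNat (List ℕ) x.2).length ≤ x.1.length :=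
        Primrec.nat_le.comp (Primrec.list_length.comp hof) (Primrec.list_length.comp Primrec.fst)
      exact this.decide.to_comp
    · exact Computable.option_getD (Computable.option_map (Computable.list_getElem?.comp
        (kw.1.comp (primrec_joinList.to_comp.comp Computable.fst hof.to_comp))
        (Computable.const 0)) (Computable.succ.comp Computable.snd)) (Computable.const 0)
  obtain ⟨w, ww, hww⟩ := exists_wordFunction_of_sound hu
  obtain ⟨j, jw, hj⟩ := exists_wordFunction_join hw ww
  obtain ⟨π, πw, hπ⟩ := exists_wordFunction_snd
  refine reducible_iff.2 ⟨j, π, jw, πw, fun p x hp hx => ?_⟩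
  obtain ⟨r, hr, z, hz, ⟨v₀, hv₀⟩, hs⟩ := hhk p x hp hx
  set W : ℕ → ℕ := fun i => ((k (joinList (initSeg p (Denumerable.ofNat (List ℕ) i).length)
    (Denumerable.ofNat (List ℕ) i)))[0]?.map Nat.succ).getD 0 with hW
  have hprod : Produces w p W := by
    refine hww p W (fun i => ⟨(Denumerable.ofNat (List ℕ) i).length, ?_⟩) fun i m a ha => ?_
    · simp [initSeg_length]
    · by_cases hle : (Denumerable.ofNat (List ℕ) i).length ≤ m
      · simp only [initSeg_length, hle, decide_true, cond_true, Option.some.injEq] at ha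
        rw [← ha, hW]
        have : ∀ σ : List ℕ, σ = initSeg (fun n => σ.getD n 0) σ.length := by
          intro σ
          apply List.ext_getElem?
          intro n
          rw [initSeg_getElem?]
          split_ifs with hn
          · simp [hn]
          · simpa using hn
        simp only
        rw [this (Denumerable.ofNat (List ℕ) i), initSeg_length, joinList_initSeg _ _ hle,
          joinList_initSeg _ _ le_rfl]
      · simp [initSeg_length, hle] at ha
  have hWs : ∀ s m, W (Encodable.encode (initSeg s m)) =
      ((k (initSeg (join p s) (2 * m)))[0]?.map Nat.succ).getD 0 := by
    intro s m
    simp only [hW, Denumerable.ofNat_encode, initSeg_length, joinList_initSeg _ _ le_rfl]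
  have hdom : ∀ v ∈ T z, ∀ s, Names s v →
      ∃ m n, join r W (2 * Encodable.encode (initSeg s m) + 1) = n + 1 := by
    intro v hv s hsv
    obtain ⟨q, hq, -⟩ := hs s v hv hsv
    obtain ⟨m, hm⟩ := hq.exists_getElem? 0
    refine ⟨m, q 0, ?_⟩
    rw [join_odd, hWs, prefix_getElem?_eq_some (kw.2 _ _ (initSeg_prefix _ (by omega))) hm]
    rfl
  refine ⟨join r W, hj p r W hr hprod, join r W, rfl, ?_, ?_⟩
  · obtain ⟨s₀, hs₀⟩ := exists_name v₀
    obtain ⟨m, n, hmn⟩ := hdom v₀ hv₀ s₀ hs₀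
    refine ⟨n, z, by simpa only [join_even] using hz, ⟨v₀, hv₀⟩, fun v hv s hsv => ?_,
      v₀, hv₀, s₀, m, hs₀, hmn⟩
    obtain ⟨m, n, hmn⟩ := hdom v hv s hsv
    exact ⟨m, by omega⟩
  · rintro s n ⟨z', hz', -, -, v, hv, t, m, htv, ht⟩ hsn
    simp only [join_even] at hz'
    obtain rfl : z' = z := names_unique r _ _ hz' hz
    refine ⟨s, hπ p s, n, ?_, hsn⟩
    obtain ⟨q, hq, y, hy, hqy⟩ := hs t v hv htv
    rw [join_odd, hWs] at ht
    cases h0 : (k (initSeg (join p t) (2 * m)))[0]? with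
    | none => simp [h0] at ht
    | some a =>
      have h1 : q 0 = a := hq.getElem? kw h0
      have h2 : a = n := by simpa [h0] using ht
      have h3 : q 0 = y := hqy
      rwa [← h2, ← h1, h3]

theorem isFirstOrderPart_firstOrderPart (T : Problem Z V) :
    IsFirstOrderPart (firstOrderPart T) T := by
  refine ⟨firstOrderPart_reducible T, ⟨BaireSpace, inferInstance, firstOrderPart T, ?_, ?_⟩,
    fun U _ f hf => reducible_firstOrderPart hf⟩ <;>
  exact reducible_firstOrderPart (firstOrderPart_reducible T)

/-- The problem `g` may have any codomain, so the argument passes through its representative with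
codomain `ℕ`. -/
theorem IsFirstOrderPart.reducible_firstOrderPart {X Y : Type} [RepresentedSpace X]
    [RepresentedSpace Y] {g : Problem X Y} {T : Problem Z V} (h : IsFirstOrderPart g T) :
    g ≤W firstOrderPart T := by
  obtain ⟨h1, ⟨U, _, g', h2, h3⟩, -⟩ := h
  exact h2.trans (Weihrauch.reducible_firstOrderPart (h3.trans h1))

end

/-! ### Reduction of the tree pigeonhole principle to the pigeonhole principle -/

/-- Somewhere density yields a full copy, and the table must have an entry at some initial segment
of its name. That segment is the required `s`; it inherits closure under meets from the copy. -/
theorem exists_goodAt {u : ℕ → ℕ} {b : Bool} {ρ : Node}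
    (hd : ∀ S, IsLeftRightTreeCopy S → S ⊆ colourClass u b → ∀ s, Names s S →
      ∃ m, u (2 * Encodable.encode (initSeg s m) + 1) ≠ 0)
    (h : SomewhereDense (colourClass u b) ρ) : ∃ s, GoodAt u b ρ s := by
  classical
  obtain ⟨S, hS, -, hS'⟩ := exists_isLeftRightTreeCopy (F := ∅) 0 h (by simp) (by simp)
  set χ : ℕ → Bool := fun n => decide (∃ σ ∈ S, Encodable.encode σ = n) with hχ
  have hχS : ∀ σ, χ (Encodable.encode σ) = true ↔ σ ∈ S := by
    intro σ
    simp [hχ, Encodable.encode_inj]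
  obtain ⟨m, hm⟩ := hd S hS (fun σ hσ => (hS' σ hσ).2.1) (fun n => (χ n).toNat) fun σ => by
    by_cases hσ : σ ∈ S
    · simp [hσ, (hχS σ).2 hσ]
    · have : χ (Encodable.encode σ) = false := by
        rw [← Bool.not_eq_true, hχS]
        exact hσ
      simp [hσ, this]
  set s : List Bool := (List.range m).map χ with hs
  have hmem : ∀ σ, σ ∈ members s ↔ σ ∈ S ∧ Encodable.encode σ < m := by
    intro σ
    rw [mem_members, hs, ← hχS]
    by_cases hlt : Encodable.encode σ < m
    · simp [hlt]
    · simp [hlt]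
  refine ⟨s, ?_, fun σ hσ => ?_, fun σ hσ τ hτ μ hμ h1 h2 => ?_⟩
  · have : s.map Bool.toNat = initSeg (fun n => (χ n).toNat) m := by
      simp [hs, initSeg]
    rwa [answerIndex, this]
  · obtain ⟨h1, h2, -⟩ := hS' σ ((hmem σ).1 hσ).1
    exact ⟨h1, h2⟩
  · refine (hmem μ).2 ⟨hS.mem_of_split ((hmem σ).1 hσ).1 ((hmem τ).1 hτ).1 h1 h2, ?_⟩
    exact (encode_le_of_prefix ((List.prefix_append _ _).trans h1)).trans_lt ((hmem σ).1 hσ).2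

/-- New vertices are given length at least `s.length`, hence codes beyond `s`, so the name of the
extended copy still begins with `s`. -/
theorem GoodAt.exists_copy {u : ℕ → ℕ} {b : Bool} {ρ : Node} {s : List Bool}
    (hg : GoodAt u b ρ s) (hd : ∀ ε ∈ ends ρ s, SomewhereDense (colourClass u b) ε) :
    ∃ S q, IsLeftRightTreeCopy S ∧ S ⊆ colourClass u b ∧ Names q S ∧
      initSeg q s.length = s.map Bool.toNat := by
  classical
  obtain ⟨-, hg1, hg2⟩ := hg
  obtain ⟨S, hS, hFS, hS'⟩ := exists_isLeftRightTreeCopy (P := colourClass u b)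
    (F := {σ | σ ∈ members s}) (ρ := ρ) s.length (hd ρ (by simp [ends]))
    (fun σ hσ => ⟨(hg1 σ hσ).1, (hg1 σ hσ).2, fun i => hd _ (append_mem_ends hσ i)⟩)
    fun σ hσ τ hτ μ h1 h2 => hg2 σ hσ τ hτ μ (mem_nodesBelow.2
      ((encode_le_of_prefix ((List.prefix_append _ _).trans h1)).trans_lt
        (List.getElem?_eq_some_iff.1 (mem_members.1 hσ)).1)) h1 h2
  have hmem : ∀ σ, Encodable.encode σ < s.length → (σ ∈ S ↔ σ ∈ members s) := by
    refine fun σ hlt => ⟨fun hσ => (hS' σ hσ).2.2.resolve_left ?_, fun hσ => hFS hσ⟩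
    have := length_le_encode σ
    omega
  refine ⟨S, fun n => if h : n < s.length then s[n].toNat else
    if ∃ σ ∈ S, Encodable.encode σ = n then 1 else 0, hS, fun σ hσ => (hS' σ hσ).2.1,
    fun σ => ?_, ?_⟩
  · by_cases hlt : Encodable.encode σ < s.length
    · have h1 := hmem σ hlt
      rw [mem_members, List.getElem?_eq_getElem hlt, Option.some_inj] at h1
      by_cases hσ : σ ∈ S
      · simp [hlt, hσ, h1.1 hσ]
      · have h2 : s[Encodable.encode σ] = false := by
          rw [← Bool.not_eq_true]
          exact fun h => hσ (h1.2 h)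
        simp [hlt, hσ, h2]
    · simp [hlt, Encodable.encode_inj]
  · refine List.ext_getElem (by simp [initSeg_length]) fun n h1 h2 => ?_
    rw [List.length_map] at h2
    simp [initSeg, h2]

/-- The answer that is determined by the preferred end `j`. -/
noncomputable def endAnswer (U : List ℕ) (j : ℕ) : Option ℕ :=
  (findFirst U).bind fun d => (if j = (ends [] d.2).length then some d.2 else
    ((ends [] d.2)[j]?).bind fun ε => findAbove U (!d.1) ε).map
      fun s => U.getD (answerIndex s) 0 - 1

theorem primrec_endAnswer {α : Type} [Primcodable α] {f : α → List ℕ} {g : α → ℕ}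
    (hf : Primrec f) (hg : Primrec g) : Primrec fun a => endAnswer (f a) (g a) := by
  refine Primrec.option_bind (primrec_findFirst.comp hf) (Primrec.option_map ?_ ?_)
  · have hends : Primrec fun x : α × Bool × List Bool => ends [] x.2.2 :=
      primrec_ends.comp (Primrec.const []) (Primrec.snd.comp Primrec.snd)
    refine Primrec.ite (Primrec.eq.comp (hg.comp Primrec.fst) (Primrec.list_length.comp hends))
      (Primrec.option_some.comp (Primrec.snd.comp Primrec.snd)) ?_
    exact Primrec.option_bind (Primrec.list_getElem?.comp hends (hg.comp Primrec.fst))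
      (primrec_findAbove (hf.comp (Primrec.fst.comp Primrec.fst))
        (Primrec.not.comp (Primrec.fst.comp (Primrec.snd.comp Primrec.fst))) Primrec.snd)
  · exact Primrec.pred.comp ((Primrec.list_getD 0).comp (hf.comp (Primrec.fst.comp Primrec.fst))
      (primrec_answerIndex.comp Primrec.snd))

/-- The `n`-th symbol of the instance of the pigeonhole principle. -/
noncomputable def endColouring (U : List ℕ) (n : ℕ) : Option ℕ :=
  if n ≤ U.length + 1 then (findFirst U).map fun d =>
    if n = 0 then (ends [] d.2).length + 1 else preferredEnd U d.1 d.2 else none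

theorem primrec_endColouring : Primrec₂ endColouring := by
  refine Primrec.ite (Primrec.nat_le.comp Primrec.snd (Primrec.succ.comp
    (Primrec.list_length.comp Primrec.fst))) (Primrec.option_map
    (primrec_findFirst.comp Primrec.fst) ?_) (Primrec.const none)
  refine Primrec.ite (Primrec.eq.comp (Primrec.snd.comp Primrec.fst) (Primrec.const 0))
    (Primrec.succ.comp (Primrec.list_length.comp (primrec_ends.comp (Primrec.const [])
      (Primrec.snd.comp Primrec.snd)))) ?_
  exact primrec_preferredEnd (Primrec.fst.comp Primrec.fst) (Primrec.fst.comp Primrec.snd)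
    (Primrec.snd.comp Primrec.snd)

theorem preferredEnd_le (U : List ℕ) (b : Bool) (s : List Bool) :
    preferredEnd U b s ≤ (ends [] s).length := List.findIdx_le_length

/-- If all ends fail to prefer the other colour at infinitely many stages, then `b` is somewhere
dense above each of them. -/
theorem somewhereDense_of_not_prefersOther {u : ℕ → ℕ} {b : Bool} {ρ : Node}
    (hu : ∀ b, (colourClass u b)ᶜ = colourClass u (!b))
    (hd : SomewhereDense (colourClass u (!b)) ρ → ∃ s, GoodAt u (!b) ρ s)
    (h : ∃ᶠ m in Filter.atTop, ¬ PrefersOther (initSeg u m) b ρ) :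
    SomewhereDense (colourClass u b) ρ := by
  by_cases hex : ∃ m s, findAbove (initSeg u m) (!b) ρ = some s
  · obtain ⟨m₀, s, hs⟩ := hex
    have h1 : ∃ᶠ m in Filter.atTop, ∃ ε ∈ ends ρ s, Prefers (initSeg u m) b ε := by
      refine (h.and_eventually (Filter.eventually_ge_atTop m₀)).mono fun m hm => ?_
      have := hm.1
      simp only [PrefersOther, findAbove_mono hm.2 hs, Option.toList_some, List.mem_singleton,
        exists_eq_left] at this
      push Not at this
      exact this
    -- There are finitely many ends, so a single one prefers `b` infinitely often.
    have h2 : ∃ ε ∈ ends ρ s, ∃ᶠ m in Filter.atTop, Prefers (initSeg u m) b ε := by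
      by_contra hn
      push Not at hn
      refine h1 ?_
      have : ∀ᶠ m in Filter.atTop, ∀ ε ∈ {ε | ε ∈ ends ρ s}, ¬ Prefers (initSeg u m) b ε :=
        (Filter.eventually_all_finite (List.finite_toSet _)).2 fun ε hε => by
          simpa using hn ε hε
      exact this.mono fun m hm ⟨ε, hε, hp⟩ => hm ε hε hp
    obtain ⟨ε, hε, hp⟩ := h2
    have hg := (good_initSeg.1 (good_of_findAbove hs)).1
    exact (somewhereDense_of_prefers hu hp).of_prefix
      (prefix_of_mem_ends (fun σ hσ => (hg.2.1 σ hσ).1) hε)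
  -- If the search for the other colour never succeeds, that colour cannot be dense above `ρ`.
  · refine (somewhereDense_or_dense hu b ρ).resolve_right fun hdense => hex ?_
    obtain ⟨s, hs⟩ := hd ⟨ρ, List.prefix_rfl, hdense⟩
    exact exists_findAbove hs

/-- Search results are permanent, and the table entry read lies inside the input already at stage
`m`. -/
theorem endAnswer_mono {u : ℕ → ℕ} {m n j a : ℕ} (h : m ≤ n)
    (ha : endAnswer (initSeg u m) j = some a) : endAnswer (initSeg u n) j = some a := by
  have key : ∀ {b ρ s}, Good (initSeg u m) b ρ s →
      (initSeg u n).getD (answerIndex s) 0 = (initSeg u m).getD (answerIndex s) 0 := by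
    intro b ρ s hg
    have := (good_initSeg.1 hg).2.1
    rw [getD_initSeg, getD_initSeg, if_pos this, if_pos (this.trans_le h)]
  simp only [endAnswer, Option.bind_eq_some_iff, Option.map_eq_some_iff] at ha ⊢
  obtain ⟨⟨b, s⟩, hd, t, ht, rfl⟩ := ha
  refine ⟨(b, s), findFirst_mono h hd, t, ?_, ?_⟩
  · split_ifs at ht ⊢ with hj
    · exact ht
    · rw [Option.bind_eq_some_iff] at ht ⊢
      obtain ⟨ε, h1, h2⟩ := ht
      exact ⟨ε, h1, findAbove_mono h h2⟩
  · split_ifs at ht with hj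
    · cases ht
      rw [key (good_of_findFirst hd)]
    · rw [Option.bind_eq_some_iff] at ht
      obtain ⟨ε, h1, h2⟩ := ht
      rw [key (good_of_findAbove h2)]

/-- A preferred end that is chosen infinitely often determines an answer that is given by a
copy of the full binary tree. -/
theorem exists_endAnswer {u : ℕ → ℕ} {b : Bool} {s : List Bool} {m₀ j : ℕ}
    (hu : ∀ b, (colourClass u b)ᶜ = colourClass u (!b))
    (hd : ∀ b ρ, SomewhereDense (colourClass u b) ρ → ∃ s, GoodAt u b ρ s)
    (hs : findFirst (initSeg u m₀) = some (b, s))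
    (hj : ∃ᶠ m in Filter.atTop, preferredEnd (initSeg u m) b s = j) :
    ∃ m b' S q n,
      endAnswer (initSeg u m) j = some (u (2 * Encodable.encode (initSeg q n) + 1) - 1) ∧
      u (2 * Encodable.encode (initSeg q n) + 1) ≠ 0 ∧
      IsLeftRightTreeCopy S ∧ S ⊆ colourClass u b' ∧ Names q S := by
  classical
  have hgood := good_of_findFirst hs
  by_cases hjl : j = (ends [] s).length
  · have hdense : ∀ ε ∈ ends [] s, SomewhereDense (colourClass u b) ε := by
      intro ε hε
      refine somewhereDense_of_not_prefersOther hu (hd _ _) (hj.mono fun m hm => ?_)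
      have := List.findIdx_eq_length.1 (hm.trans hjl) ε hε
      simpa using this
    obtain ⟨hg, hlt, -⟩ := good_initSeg.1 hgood
    obtain ⟨S, q, h1, h2, h3, h4⟩ := hg.exists_copy hdense
    refine ⟨m₀, b, S, q, s.length, ?_, ?_, h1, h2, h3⟩
    · rw [h4]
      simp only [endAnswer, hs, Option.bind_some, hjl, if_true, Option.map_some, getD_initSeg,
        if_pos hlt]
      rfl
    · rw [h4]
      exact hg.1
  · have hjlt : j < (ends [] s).length := by
      obtain ⟨m, hm⟩ := hj.exists
      exact lt_of_le_of_ne (hm ▸ preferredEnd_le _ _ _) hjl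
    have hp : ∃ᶠ m in Filter.atTop, PrefersOther (initSeg u m) b (ends [] s)[j] := by
      refine hj.mono fun m hm => ?_
      have hlt : (ends [] s).findIdx (fun ε => decide (PrefersOther (initSeg u m) b ε)) <
          (ends [] s).length := by
        rw [← hm] at hjlt
        exact hjlt
      have := List.findIdx_getElem (w := hlt)
      rw [decide_eq_true_eq] at this
      convert this
      exact hm.symm
    obtain ⟨m₁, hm₁, t, ht, -⟩ := Filter.frequently_atTop.1 hp m₀
    rw [Option.mem_toList] at ht
    have ht : findAbove (initSeg u m₁) (!b) (ends [] s)[j] = some t := ht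
    have hdense : ∀ ε ∈ ends (ends [] s)[j] t, SomewhereDense (colourClass u (!b)) ε := by
      intro ε hε
      refine somewhereDense_of_not_prefers hu
        ((hp.and_eventually (Filter.eventually_ge_atTop m₁)).mono fun m hm => ?_)
      obtain ⟨t', ht', h1⟩ := hm.1
      rw [findAbove_mono hm.2 ht, Option.toList_some, List.mem_singleton] at ht'
      subst ht'
      exact h1 ε hε
    obtain ⟨hg, hlt, -⟩ := good_initSeg.1 (good_of_findAbove ht)
    obtain ⟨S, q, h1, h2, h3, h4⟩ := hg.exists_copy hdense
    refine ⟨m₁, !b, S, q, t.length, ?_, ?_, h1, h2, h3⟩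
    · rw [h4]
      simp only [endAnswer, findFirst_mono hm₁ hs, Option.bind_some, if_neg hjl,
        List.getElem?_eq_getElem hjlt, ht, Option.map_some, getD_initSeg, if_pos hlt]
      rfl
    · rw [h4]
      exact hg.1

/-- Of `T` only this is needed: left-right copies are solutions, so the table has entries on their
names and those entries are correct. -/
theorem firstOrderPart_reducible_RT1Plus {T : Problem (Node → Fin 2) (Set Node)}
    (hT : ∀ c, TT1LeftRight 2 c ⊆ T c) : firstOrderPart T ≤W RT1Plus := by
  obtain ⟨h, hw, hh⟩ := exists_wordFunction primrec_endColouring.to_comp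
  have hk : Computable₂ fun (σ : List ℕ) (_ : ℕ) =>
      (σ[1]?).bind fun j => endAnswer (evens σ) j :=
    (Primrec.option_bind (Primrec.list_getElem?.comp Primrec.fst (Primrec.const 1))
      (primrec_endAnswer (primrec_evens.comp (Primrec.fst.comp Primrec.fst))
        Primrec.snd).to₂).to_comp
  obtain ⟨k, kw, hkk⟩ := exists_wordFunction_of_sound hk
  refine reducible_iff.2 ⟨h, k, hw, kw, ?_⟩
  rintro p u rfl ⟨n₀, c, hc, hne, hdom, -⟩
  have hc : ∀ σ, p (2 * Encodable.encode σ) = c σ := hc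
  have hu : ∀ b, (colourClass p b)ᶜ = colourClass p (!b) := by
    intro b
    ext σ
    simp only [colourClass, Set.mem_compl_iff, Set.mem_ofPred_eq, hc]
    have := (c σ).2
    cases b <;> simp <;> omega
  have hsol : ∀ b S, IsLeftRightTreeCopy S → S ⊆ colourClass p b → S ∈ T c := by
    intro b S hS hSb
    refine hT c ⟨hS, if b then 1 else 0, fun σ hσ => Fin.ext ?_⟩
    have h1 : p (2 * Encodable.encode σ) = b.toNat := hSb hσ
    rw [← hc, h1]
    cases b <;> rfl
  have hgood : ∀ b ρ, SomewhereDense (colourClass p b) ρ → ∃ s, GoodAt p b ρ s :=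
    fun b ρ hsd => exists_goodAt (fun S hS hSb s hs => hdom S (hsol b S hS hSb) s hs) hsd
  obtain ⟨m₁, hm₁⟩ : ∃ m, (findFirst (initSeg p m)).isSome := by
    have : ∃ b s, GoodAt p b [] s := by
      rcases somewhereDense_or_dense hu true [] with hsd | hsd
      · exact ⟨true, hgood _ _ hsd⟩
      · exact ⟨false, hgood _ _ ⟨[], List.prefix_rfl, hsd⟩⟩
    obtain ⟨b, s, hs⟩ := this
    obtain ⟨m, d, hd⟩ := exists_findFirst hs
    exact ⟨m, by simp [hd]⟩
  classical
  have hex : ∃ m, (findFirst (initSeg p m)).isSome := ⟨m₁, hm₁⟩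
  obtain ⟨m₀, hm₀, hmin⟩ : ∃ m, (findFirst (initSeg p m)).isSome ∧
      ∀ i < m, findFirst (initSeg p i) = none :=
    ⟨Nat.find hex, Nat.find_spec hex, fun i hi => by simpa using Nat.find_min hex hi⟩
  obtain ⟨⟨b, s⟩, hs⟩ := Option.isSome_iff_exists.1 hm₀
  set c' : NatColouring := ⟨(ends [] s).length + 1, fun n =>
    ⟨preferredEnd (initSeg p (max n m₀)) b s, Nat.lt_succ_of_le (preferredEnd_le _ _ _)⟩⟩ with hc'
  refine ⟨fun n => Nat.casesOn n ((ends [] s).length + 1) fun n =>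
    preferredEnd (initSeg p (max n m₀)) b s, hh p _ fun n => ?_, c', ⟨rfl, fun n => rfl⟩, ?_, ?_⟩
  -- Symbol `n` is withheld until length `n - 1`, and everything until the first search succeeds at
  -- `m₀`. The colours, shifted by one behind the leading number of colours, thus follow all later
  -- stages.
  · refine ⟨max (n - 1) m₀, ?_, fun i hi => ?_⟩
    · have h1 : n ≤ max (n - 1) m₀ + 1 := by omega
      simp only [endColouring, initSeg_length, if_pos h1, findFirst_mono (le_max_right _ _) hs,
        Option.map_some]
      cases n <;> simp
    · rcases lt_max_iff.1 hi with hi | hi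
      · rw [endColouring, initSeg_length, if_neg (by omega)]
      · rw [endColouring, hmin i hi]
        simp
  · obtain ⟨i, hi⟩ := Finite.exists_infinite_fiber c'.2
    rw [Set.infinite_coe_iff] at hi
    refine ⟨i, ?_⟩
    change {n | (c'.2 n : ℕ) = i}.Infinite
    convert hi using 1
    ext n
    simp [Fin.ext_iff]
  · intro t j hj htj
    have htj : t 0 = j := htj
    have hj : {n | (c'.2 n : ℕ) = j}.Infinite := hj
    have hfreq : ∃ᶠ m in Filter.atTop, preferredEnd (initSeg p m) b s = j := by
      refine Filter.frequently_atTop.2 fun N => ?_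
      obtain ⟨n, hn, hlt⟩ := hj.exists_gt N
      exact ⟨max n m₀, hlt.le.trans (le_max_left _ _), hn⟩
    obtain ⟨m, b', S, q, n, h1, h2, h3, h4, h5⟩ := exists_endAnswer hu hgood hs hfreq
    refine ⟨fun _ => p (2 * Encodable.encode (initSeg q n) + 1) - 1,
      -- This length includes position `1`, which holds the chosen colour even if `m = 0`, and at
      -- least `m` symbols of `p`.
      hkk _ _ (fun _ => ⟨2 * m + 2, ?_⟩) (fun _ M a ha => ?_), _, ?_, rfl⟩
    · rw [initSeg_getElem?, if_pos (by omega), show (1 : ℕ) = 2 * 0 + 1 from rfl, join_odd, htj,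
        evens_initSeg, Option.bind_some, endAnswer_mono (by omega) h1]
      rfl
    · rw [Option.bind_eq_some_iff] at ha
      obtain ⟨j', hj', ha⟩ := ha
      obtain ⟨-, hj'⟩ := initSeg_getElem?_eq_some.1 hj'
      rw [show (1 : ℕ) = 2 * 0 + 1 from rfl, join_odd, htj] at hj'
      subst hj'
      rw [evens_initSeg] at ha
      have h6 := endAnswer_mono (le_max_left (M / 2) m) ha
      have h7 := endAnswer_mono (le_max_right (M / 2) m) h1
      exact Option.some_injective _ (h6.symm.trans h7)
    · exact ⟨c, hc, hne, hdom, S, hsol b' S h3 h4, q, n, h5, (Nat.succ_pred_eq_of_ne_zero h2).symm⟩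

theorem TT1LeftRight_subset_TT1 (k : ℕ) (c : Node → Fin k) : TT1LeftRight k c ⊆ TT1 k c :=
  fun _ hS => ⟨hS.1.isTreeCopy, hS.2⟩

end Weihrauch

theorem proposition14 :
    ∀ T ∈ ({TT1 2, TT1LeftRight 2} : Set (Problem (Node → Fin 2) (Set Node))),
      (∃ (X : Type) (_ : RepresentedSpace X) (Y : Type) (_ : RepresentedSpace Y)
        (g : Problem X Y), IsFirstOrderPart g T) ∧
      ∀ (X : Type) [RepresentedSpace X] (Y : Type) [RepresentedSpace Y] (g : Problem X Y),
        IsFirstOrderPart g T → g ≤W RT1Plus ∧ FinitelyGuessable g := by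
  intro T hT
  have hsub : ∀ c, TT1LeftRight 2 c ⊆ T c := by
    rcases hT with rfl | rfl
    · exact TT1LeftRight_subset_TT1 2
    · exact fun c => subset_rfl
  refine ⟨⟨BaireSpace, inferInstance, ℕ, inferInstance, firstOrderPart T,
    isFirstOrderPart_firstOrderPart T⟩, fun X _ Y _ g hg => ?_⟩
  have hred := hg.reducible_firstOrderPart.trans (firstOrderPart_reducible_RT1Plus hsub)
  exact ⟨hred, finitelyGuessable_of_reducible hred⟩
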